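/- Let $\mathcal H$ be a (real or complex) separable Hilbert space and let $\mathcal A:D(\mathcal A)\subset\mathcal H\to\mathcal H$ be a densely defined, closed, self-adjoint, positive definite linear operator with a complete orthonormal system of eigenvectors $(\psi_j)_{j\ge 0}$, $\mathcal A\psi_j=\lambda_j\psi_j$, $0<\lambda_0\le\lambda_1\le\cdots$, $\lambda_j\to\infty$. Let $\mathfrak T(t)$, $t\ge 0$, be the semigroup generated by $-\mathcal A$. For $\alpha\in(0,1)$ let $\mathcal A^{\alpha}x=\sum_j\lambda_j^{\alpha}\langle x,\psi_j\rangle\psi_j$, with domain $\mathcal H_\alpha=D(\mathcal A^\alpha)=\{x:\sum_j\lambda_j^{2\alpha}|\langle x,\psi_j\rangle|^2<\infty\}$ and norm $\|x\|_\alpha=\|\mathcal A^\alpha x\|$. Let $\mathcal P^n$ be the orthogonal projection of $\mathcal H$ onto $\operatorname{span}\{\psi_0,\dots,\psi_n\}$. Let $\tau>0$ and $0=\varsigma_0=\varrho_0<\varrho_1<\varsigma_1<\varrho_2<\cdots<\varsigma_q<\varrho_{q+1}=T$. Let $\mathfrak{PC}_T^\alpha$ be the space of functions $y:[-\tau,T]\to\mathcal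 H_\alpha$ that are continuous on $[-\tau,\varrho_1]$ and on each $(\varrho_i,\varrho_{i+1}]$, $1\le i\le q$, and have right limits at $\varrho_1,\dots,\varrho_q$, with norm $\|y\|_{T,\alpha}=\sup_{t\in[-\tau,T]}\|y(t)\|_\alpha$. Let $\mathfrak{PC}_0^\alpha$ be the space of functions $[-\tau,0]\to\mathcal H_\alpha$ that are continuous except at finitely many points, left-continuous, and have right limits, with norm $\|x\|_{0,\alpha}=\sup_{[-\tau,0]}\|x(\theta)\|_\alpha$. For $y\in\mathfrak{PC}_T^\alpha$ and $s\in[0,T]$ let $y_s\in\mathfrak{PC}_0^\alpha$, $y_s(\theta)=y(s+\theta)$; for $x\in\mathfrak{PC}_0^\alpha$ let $(\mathcal P^nx)(\theta)=\mathcal P^n(x(\theta))$. Let $\chi\in\mathfrak{PC}_0^\alpha$ be locally Hölder continuous as a map $[-\tau,0]\to\mathcal H$, with $\chi(\theta)\in D(\mathcal A)$ for all $\theta\in[-\tau,0]$; let $\bar\chi=\chi$ on $[-\tau,0]$ and $\bar\chi=\chi(0)$ on $[0,T]$. Let $R>0$ and $r=R+\|\chi\|_{0,\alpha}$. Assume: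 (i) $\mathfrak F:[0,T]\times\mathfrak{PC}_0^\alpha\to\mathcal H$ is continuous, and for some $\eta\in(0,1]$, $L_{\mathfrak F}>0$, one has $\|\mathfrak F(t,x)-\mathfrak F(s,z)\|\le L_{\mathfrak F}\big(|t-s|^\eta+\|x-z\|_{0,\alpha}\big)$ for all $t,s\in[0,T]$ and all $x,z\in\mathfrak{PC}_0^\alpha$ with $\|x\|_{0,\alpha},\|z\|_{0,\alpha}\le r$; (ii) for $i=1,\dots,q$, $h_i:(\varrho_i,\varsigma_i]\times\mathcal H_\alpha\to\mathcal H_\alpha$ is continuous, and for some $L_{h_i}>0$, $\|h_i(t,x)-h_i(s,z)\|_\alpha\le L_{h_i}\big(|t-s|+\|x-z\|_\alpha\big)$ for all $t,s\in(\varrho_i,\varsigma_i]$ and all $x,z\in\mathcal H_\alpha$ with $\|x\|_\alpha,\|z\|_\alpha\le r$; moreover, for some $M_h>0$, $\|h_i(t,x)\|_\alpha\le M_h$ for all $i$, all $t\in(\varrho_i,\varsigma_i]$ and all $x\in\mathcal H_\alpha$. For each $n\ge0$ let $y_n\in\mathfrak{PC}_T^\alpha$ with $\|y_n-\bar\chi\|_{T,\alpha}\le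 R$ be an approximate solution, i.e. (all integrals existing as Bochner integrals in $\mathcal H$) $$y_n(t)=\begin{cases}\chi(t), & t\in[-\tau,0],\\ \mathfrak T(t)\chi(0)+\int_0^t\mathfrak T(t-s)\,\mathfrak F(s,\mathcal P^n(y_n)_s)\,ds, & t\in[0,\varrho_1],\\ h_i(t,\mathcal P^ny_n(\varrho_i^-)), & t\in(\varrho_i,\varsigma_i],\ 1\le i\le q,\\ \mathfrak T(t-\varsigma_i)h_i(\varsigma_i,\mathcal P^ny_n(\varrho_i^-))+\int_{\varsigma_i}^t\mathfrak T(t-s)\,\mathfrak F(s,\mathcal P^n(y_n)_s)\,ds, & t\in(\varsigma_i,\varrho_{i+1}],\ 1\le i\le q.\end{cases}$$ Then $\{y_n\}$ is a Cauchy sequence in $\mathfrak{PC}_T^\alpha$, and consequently there is $y\in\mathfrak{PC}_T^\alpha$ with $y_n\to y$ in $\mathfrak{PC}_T^\alpha$. -/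

import Mathlib

open Set Filter Topology MeasureTheory
open scoped InnerProductSpace ENNReal NNReal

noncomputable section

namespace FaedoGalerkin

/-! ### Time grid -/

/-- The delay `τ > 0`, the horizon `T`, and impulse times
`0 = ς₀ = ρ₀ < ρ₁ < ς₁ < ρ₂ < ⋯ < ς_q < ρ_{q+1} = T`
(entries of `ρ`, `ς` with larger index play no role). -/
structure TimeGrid where
  τ : ℝ
  T : ℝ
  q : ℕ
  ρ : ℕ → ℝ
  ς : ℕ → ℝ
  τ_pos : 0 < τ
  ρ_zero : ρ 0 = 0
  ς_zero : ς 0 = 0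
  ρ_lt_ς : ∀ i, 1 ≤ i → i ≤ q → ρ i < ς i
  ς_lt_ρ : ∀ i, i ≤ q → ς i < ρ (i + 1)
  ρ_last : ρ (q + 1) = T

namespace TimeGrid

variable (G : TimeGrid)

/-- The jump times `ρ₁, …, ρ_q`. -/
def jumps : Set ℝ := G.ρ '' Icc 1 G.q

theorem finite_jumps : G.jumps.Finite := (Set.finite_Icc 1 G.q).image _

theorem T_pos : 0 < G.T := by
  have hς : ∀ i, i ≤ G.q → 0 ≤ G.ς i := by
    intro i
    induction i with
    | zero => intro _; exact G.ς_zero.ge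
    | succ k ih =>
      intro hk
      have h1 := ih (by omega)
      have h2 := G.ς_lt_ρ k (by omega)
      have h3 := G.ρ_lt_ς (k + 1) (by omega) hk
      linarith
  have h1 := hς G.q le_rfl
  have h2 := G.ς_lt_ρ G.q le_rfl
  rw [G.ρ_last] at h2
  linarith

theorem neg_τ_le_zero : -G.τ ≤ 0 := by linarith [G.τ_pos]

theorem neg_τ_le_T : -G.τ ≤ G.T := by linarith [G.τ_pos, G.T_pos]

end TimeGrid

/-! ### Piecewise continuous functions -/

section PC

variable {𝕜 : Type*} [RCLike 𝕜] {E : Type*} [NormedAddCommGroup E] [NormedSpace 𝕜 E] {a b : ℝ}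

/-- `f : [a, b] → E` is continuous at every point outside `J`, is left-continuous everywhere and has
a right limit everywhere. -/
structure IsPiecewiseCont (J : Set ℝ) (f : Icc a b → E) : Prop where
  continuousAt : ∀ t : Icc a b, (t : ℝ) ∉ J → ContinuousAt f t
  left : ∀ t : Icc a b, ContinuousWithinAt f (Iic t) t
  right : ∀ t : Icc a b, ∃ l : E, Tendsto f (𝓝[>] t) (𝓝 l)

namespace IsPiecewiseCont

theorem zero (J : Set ℝ) : IsPiecewiseCont J (fun _ : Icc a b => (0 : E)) :=
  ⟨fun _ _ => continuousAt_const, fun _ => continuousWithinAt_const,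
    fun _ => ⟨0, tendsto_const_nhds⟩⟩

theorem mono {J K : Set ℝ} (h : J ⊆ K) {f : Icc a b → E} (hf : IsPiecewiseCont J f) :
    IsPiecewiseCont K f :=
  ⟨fun t ht => hf.continuousAt t fun hJ => ht (h hJ), hf.left, hf.right⟩

theorem add {J : Set ℝ} {f g : Icc a b → E} (hf : IsPiecewiseCont J f)
    (hg : IsPiecewiseCont J g) : IsPiecewiseCont J (fun t => f t + g t) := by
  refine ⟨fun t ht => (hf.continuousAt t ht).add (hg.continuousAt t ht),
    fun t => (hf.left t).add (hg.left t), fun t => ?_⟩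
  obtain ⟨l, hl⟩ := hf.right t
  obtain ⟨m, hm⟩ := hg.right t
  exact ⟨l + m, hl.add hm⟩

theorem comp {F : Type*} [NormedAddCommGroup F] {J : Set ℝ} {f : Icc a b → E}
    (hf : IsPiecewiseCont J f) {g : E → F} (hg : Continuous g) :
    IsPiecewiseCont J (fun t => g (f t)) := by
  refine ⟨fun t ht => hg.continuousAt.comp (hf.continuousAt t ht),
    fun t => hg.continuousAt.comp_continuousWithinAt (hf.left t), fun t => ?_⟩
  obtain ⟨l, hl⟩ := hf.right t
  exact ⟨g l, (hg.tendsto l).comp hl⟩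

end IsPiecewiseCont

variable (𝕜 E a b)

/-- Bounded functions `[a, b] → E` that are piecewise continuous with jumps only in the given set
`J`, with the supremum norm. -/
def PCSpace (J : Set ℝ) : Submodule 𝕜 (lp (fun _ : Icc a b => E) ∞) where
  carrier := {f | IsPiecewiseCont J (f : Icc a b → E)}
  zero_mem' := IsPiecewiseCont.zero J
  add_mem' hf hg := IsPiecewiseCont.add hf hg
  smul_mem' c _ hf := IsPiecewiseCont.comp hf (continuous_const_smul c)

/-- Bounded functions `[a, b] → E` that are piecewise continuous with finitely many jumps (at
arbitrary places), with the supremum norm. -/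
def FinPCSpace : Submodule 𝕜 (lp (fun _ : Icc a b => E) ∞) where
  carrier := {f | ∃ J : Set ℝ, J.Finite ∧ IsPiecewiseCont J (f : Icc a b → E)}
  zero_mem' := ⟨∅, Set.finite_empty, IsPiecewiseCont.zero ∅⟩
  add_mem' := by
    rintro f g ⟨J, hJ, hf⟩ ⟨K, hK, hg⟩
    exact ⟨J ∪ K, hJ.union hK,
      (hf.mono subset_union_left).add (hg.mono subset_union_right)⟩
  smul_mem' := by
    rintro c f ⟨J, hJ, hf⟩
    exact ⟨J, hJ, hf.comp (continuous_const_smul c)⟩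

variable {𝕜 E a b}

/-- Post-composition with a bounded linear map. -/
def FinPCSpace.map (L : E →L[𝕜] E) (x : FinPCSpace 𝕜 E a b) : FinPCSpace 𝕜 E a b :=
  ⟨⟨fun t => L ((x : lp (fun _ : Icc a b => E) ∞) t), by
      refine memℓp_infty ⟨‖L‖ * ‖x‖, ?_⟩
      rintro _ ⟨t, rfl⟩
      exact (L.le_opNorm _).trans (mul_le_mul_of_nonneg_left
        (lp.norm_apply_le_norm ENNReal.top_ne_zero
          (x : lp (fun _ : Icc a b => E) ∞) t) (norm_nonneg L))⟩, by
    obtain ⟨J, hJ, hx⟩ := x.2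
    exact ⟨J, hJ, hx.comp L.continuous⟩⟩

variable (𝕜 E) in
/-- The space `PC_T` over `E`: functions `[-τ, T] → E` that are continuous on `[-τ, ρ₁]` and on each
`(ρ_i, ρ_{i+1}]`, with right limits at the `ρ_i`; supremum norm. -/
abbrev SolSpace (G : TimeGrid) : Type _ := PCSpace 𝕜 E (-G.τ) G.T G.jumps

variable (𝕜 E) in
/-- The space `PC_0` over `E` of histories: piecewise continuous functions `[-τ, 0] → E`;
supremum norm. -/
abbrev HistSpace (G : TimeGrid) : Type _ := FinPCSpace 𝕜 E (-G.τ) 0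

/-- Value of `y ∈ PC_T` at a time `t` (intended for `t ∈ [-τ, T]`; `y` is extended by constants
outside). -/
def SolSpace.eval {G : TimeGrid} (y : SolSpace 𝕜 E G) (t : ℝ) : E :=
  (y : lp (fun _ : Icc (-G.τ) G.T => E) ∞) (projIcc (-G.τ) G.T G.neg_τ_le_T t)

/-- Value of `x ∈ PC_0` at a time `t` (intended for `t ∈ [-τ, 0]`; `x` is extended by constants
outside). In particular `t ↦ x.eval t` on `[-τ, T]` is `x` on `[-τ, 0]` and `x(0)` on `[0, T]`. -/
def HistSpace.eval {G : TimeGrid} (x : HistSpace 𝕜 E G) (t : ℝ) : E :=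
  (x : lp (fun _ : Icc (-G.τ) 0 => E) ∞) (projIcc (-G.τ) 0 G.neg_τ_le_zero t)

/-- The shift `[-τ, 0] → [-τ, T]`, `θ ↦ s + θ`, for `s ∈ [0, T]`. -/
def shift (G : TimeGrid) (s : Icc 0 G.T) (θ : Icc (-G.τ) 0) : Icc (-G.τ) G.T :=
  ⟨s + θ, by linarith [s.2.1, θ.2.1], by linarith [s.2.2, θ.2.2]⟩

theorem continuous_shift (G : TimeGrid) (s : Icc 0 G.T) : Continuous (shift G s) :=
  Continuous.subtype_mk (continuous_const.add continuous_subtype_val) _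

theorem strictMono_shift (G : TimeGrid) (s : Icc 0 G.T) : StrictMono (shift G s) :=
  fun _ _ h => add_lt_add_right (α := ℝ) h _

/-- The history `y_s ∈ PC_0` of `y ∈ PC_T` at time `s ∈ [0, T]`: `y_s(θ) = y(s + θ)`. -/
def SolSpace.hist {G : TimeGrid} (y : SolSpace 𝕜 E G) (s : Icc 0 G.T) : HistSpace 𝕜 E G :=
  ⟨⟨fun θ => (y : lp (fun _ : Icc (-G.τ) G.T => E) ∞) (shift G s θ), by
      refine memℓp_infty ⟨‖y‖, ?_⟩
      rintro _ ⟨t, rfl⟩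
      exact lp.norm_apply_le_norm ENNReal.top_ne_zero
        (y : lp (fun _ : Icc (-G.τ) G.T => E) ∞) _⟩, by
    have hy : IsPiecewiseCont G.jumps ((y : lp (fun _ : Icc (-G.τ) G.T => E) ∞) :
      Icc (-G.τ) G.T → E) := y.2
    have hc := continuous_shift G s
    have hm := strictMono_shift G s
    refine ⟨(fun θ : ℝ => (s : ℝ) + θ) ⁻¹' G.jumps,
      G.finite_jumps.preimage (add_right_injective (s : ℝ)).injOn, ?_, ?_, ?_⟩
    · intro θ hθ
      exact ContinuousAt.comp (g := ((y : lp (fun _ : Icc (-G.τ) G.T => E) ∞) :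
        Icc (-G.τ) G.T → E)) (hy.continuousAt (shift G s θ) hθ) hc.continuousAt
    · intro θ
      exact (hy.left (shift G s θ)).comp hc.continuousWithinAt fun _ h => hm.monotone h
    · intro θ
      obtain ⟨l, hl⟩ := hy.right (shift G s θ)
      refine ⟨l, hl.comp (tendsto_nhdsWithin_of_tendsto_nhds_of_eventually_within _
        (hc.continuousAt.tendsto.mono_left nhdsWithin_le_nhds) ?_)⟩
      filter_upwards [self_mem_nhdsWithin] with θ' h
      exact hm h⟩

end PC

/-! ### The operator, its fractional powers and its semigroup -/

section Operator

variable {𝕜 : Type*} [RCLike 𝕜] {H : Type*} [NormedAddCommGroup H] [InnerProductSpace 𝕜 H]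

/-- A complete orthonormal system `ψ_j` of eigenvectors of the unbounded operator `A`, with
eigenvalues `0 < lam 0 ≤ lam 1 ≤ ⋯` tending to infinity. -/
structure EigenSystem (A : H →ₗ.[𝕜] H) where
  lam : ℕ → ℝ
  ψ : HilbertBasis ℕ 𝕜 H
  lam_pos : 0 < lam 0
  lam_mono : Monotone lam
  lam_tendsto : Tendsto lam atTop atTop
  mem_domain : ∀ j, ψ j ∈ A.domain
  eigen : ∀ j, A ⟨ψ j, mem_domain j⟩ = (lam j : 𝕜) • ψ j

/-- The family `S(t)`, `t ≥ 0`, of bounded operators is the strongly continuous semigroup whose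
infinitesimal generator is `B`, domain included. -/
structure IsSemigroupGeneratedBy (S : ℝ → H →L[𝕜] H) (B : H →ₗ.[𝕜] H) : Prop where
  map_zero : S 0 = 1
  map_add : ∀ s t : ℝ, 0 ≤ s → 0 ≤ t → S (s + t) = S s * S t
  tendsto_zero : ∀ x : H, Tendsto (fun t => S t x) (𝓝[>] 0) (𝓝 x)
  generator : ∀ x y : H, (x, y) ∈ B.graph ↔
    Tendsto (fun t : ℝ => ((t⁻¹ : ℝ) : 𝕜) • (S t x - x)) (𝓝[>] 0) (𝓝 y)

namespace EigenSystem

variable {A : H →ₗ.[𝕜] H} (e : EigenSystem A)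

theorem lam_pos' (j : ℕ) : 0 < e.lam j := e.lam_pos.trans_le (e.lam_mono (Nat.zero_le j))

/-- The fractional power `A^α = ∑ j, lam j ^ α ⟪ψ j, ·⟫ ψ j`, with domain
`D(A^α) = {x | ∑ j, lam j ^ (2 α) |⟪ψ j, x⟫| ^ 2 < ∞}`. -/
def fracPow (α : ℝ) : H →ₗ.[𝕜] H where
  domain :=
    { carrier := {x | Memℓp (fun j => ((e.lam j ^ α : ℝ) : 𝕜) * ⟪e.ψ j, x⟫_𝕜) 2}
      zero_mem' := by simpa using zero_mem_ℓp' (p := 2) (E := fun _ : ℕ => 𝕜)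
      add_mem' := by
        intro x y hx hy
        have h := hx.add hy
        simp only [mem_ofPred_eq, inner_add_right, mul_add]
        exact h
      smul_mem' := by
        intro c x hx
        have h := hx.const_mul c
        simp only [mem_ofPred_eq, inner_smul_right, mul_left_comm _ c]
        exact h }
  toFun :=
    { toFun := fun x => e.ψ.repr.symm
        ⟨fun j => ((e.lam j ^ α : ℝ) : 𝕜) * ⟪e.ψ j, (x : H)⟫_𝕜, x.2⟩
      map_add' := by
        intro x y
        rw [← map_add]
        congr 1
        ext j
        simp only [Submodule.coe_add, inner_add_right, mul_add]
        rfl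
      map_smul' := by
        intro c x
        rw [← map_smul]
        congr 1
        ext j
        simp [inner_smul_right, mul_left_comm _ c] }

theorem repr_fracPow (α : ℝ) (x : (e.fracPow α).domain) (j : ℕ) :
    e.ψ.repr (e.fracPow α x) j = ((e.lam j ^ α : ℝ) : 𝕜) * ⟪e.ψ j, (x : H)⟫_𝕜 := by
  change e.ψ.repr (e.ψ.repr.symm _) j = _
  rw [LinearIsometryEquiv.apply_symm_apply]

theorem fracPow_injective (α : ℝ) : Function.Injective (e.fracPow α).toFun := by
  rw [injective_iff_map_eq_zero]
  intro x hx
  have hx' : e.fracPow α x = 0 := hx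
  have h0 : e.ψ.repr (x : H) = 0 := by
    ext j
    have h := e.repr_fracPow α x j
    rw [hx', map_zero] at h
    have hl : ((e.lam j ^ α : ℝ) : 𝕜) ≠ 0 :=
      RCLike.ofReal_ne_zero.2 (Real.rpow_pos_of_pos (e.lam_pos' j) α).ne'
    have h' : ⟪e.ψ j, (x : H)⟫_𝕜 = 0 := by
      rcases mul_eq_zero.1 h.symm with h | h
      · exact absurd h hl
      · exact h
    rw [e.ψ.repr_apply_apply, h']
    rfl
  exact Subtype.ext ((map_eq_zero_iff _ e.ψ.repr.injective).1 h0)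

/-- The space `H_α`: the domain of `A^α`, with the norm `‖x‖_α = ‖A^α x‖`. -/
def HFrac (α : ℝ) : Type _ := (e.fracPow α).domain

instance (α : ℝ) : AddCommGroup (e.HFrac α) :=
  inferInstanceAs (AddCommGroup (e.fracPow α).domain)

instance (α : ℝ) : Module 𝕜 (e.HFrac α) :=
  inferInstanceAs (Module 𝕜 (e.fracPow α).domain)

/-- `A^α` as a linear map on `H_α`. -/
def powMap (α : ℝ) : e.HFrac α →ₗ[𝕜] H := (e.fracPow α).toFun

instance (α : ℝ) : NormedAddCommGroup (e.HFrac α) :=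
  NormedAddCommGroup.induced _ _ (e.powMap α) (e.fracPow_injective α)

instance (α : ℝ) : NormedSpace 𝕜 (e.HFrac α) :=
  NormedSpace.induced 𝕜 _ _ (e.powMap α)

theorem HFrac.norm_def {α : ℝ} (x : e.HFrac α) : ‖x‖ = ‖e.powMap α x‖ := rfl

/-- The inclusion `H_α → H`. -/
def incl (α : ℝ) : e.HFrac α →ₗ[𝕜] H := (e.fracPow α).domain.subtype

theorem norm_sq_eq (x : H) : ‖x‖ ^ 2 = ∑' j, ‖e.ψ.repr x j‖ ^ 2 := by
  have h := lp.norm_rpow_eq_tsum (p := 2) (by norm_num) (e.ψ.repr x)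
  simp only [ENNReal.toReal_ofNat, Real.rpow_ofNat, LinearIsometryEquiv.norm_map] at h
  exact h

theorem summable_sq (x : H) : Summable fun j => ‖e.ψ.repr x j‖ ^ 2 := by
  have h := (lp.memℓp (e.ψ.repr x)).summable (by norm_num)
  simpa only [ENNReal.toReal_ofNat, Real.rpow_ofNat] using h

open Classical in
/-- The finite-dimensional space spanned by `ψ 0, …, ψ n`. -/
def span (n : ℕ) : Submodule 𝕜 H :=
  Submodule.span 𝕜 (((Finset.range (n + 1)).image e.ψ : Finset H) : Set H)

instance (n : ℕ) : FiniteDimensional 𝕜 (e.span n) :=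
  FiniteDimensional.span_finset 𝕜 _

/-- The orthogonal projection `P^n` of `H` onto the span of `ψ 0, …, ψ n`. -/
def proj (n : ℕ) : H →L[𝕜] H := (e.span n).starProjection

theorem inner_proj (n : ℕ) (x : H) (j : ℕ) :
    ⟪e.ψ j, e.proj n x⟫_𝕜 = if j ≤ n then ⟪e.ψ j, x⟫_𝕜 else 0 := by
  classical
  unfold proj
  split_ifs with hj
  · have hm : e.ψ j ∈ e.span n := Submodule.subset_span (by
      simp only [Finset.coe_image, mem_image, Finset.mem_coe, Finset.mem_range]
      exact ⟨j, by omega, rfl⟩)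
    rw [← Submodule.inner_starProjection_left_eq_right,
      Submodule.starProjection_eq_self_iff.2 hm]
  · have hm : e.ψ j ∈ (e.span n)ᗮ := by
      rw [Submodule.mem_orthogonal]
      intro u hu
      refine Submodule.span_induction (p := fun u _ => ⟪u, e.ψ j⟫_𝕜 = 0) ?_ (by simp) ?_ ?_ hu
      · intro u hu
        simp only [Finset.coe_image, mem_image, Finset.mem_coe, Finset.mem_range] at hu
        obtain ⟨i, hi, rfl⟩ := hu
        exact e.ψ.orthonormal.2 (by omega)
      · intro u v _ _ hu hv
        rw [inner_add_left, hu, hv, add_zero]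
      · intro c u _ hu
        rw [inner_smul_left, hu, mul_zero]
    rw [← Submodule.inner_starProjection_left_eq_right,
      (Submodule.starProjection_apply_eq_zero_iff _).2 hm, inner_zero_left]

theorem proj_mem_domain (n : ℕ) (α : ℝ) (x : (e.fracPow α).domain) :
    e.proj n (x : H) ∈ (e.fracPow α).domain := by
  have hx : Memℓp (fun j => ((e.lam j ^ α : ℝ) : 𝕜) * ⟪e.ψ j, (x : H)⟫_𝕜) 2 := x.2
  refine Memℓp.mono' (hx.norm) fun j => ?_
  rw [e.inner_proj]
  split_ifs
  · exact (norm_norm _).ge.trans' le_rfl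
  · rw [mul_zero, norm_zero]
    positivity

/-- `P^n` as a bounded operator on `H_α`. -/
def projFrac (n : ℕ) (α : ℝ) : e.HFrac α →L[𝕜] e.HFrac α :=
  LinearMap.mkContinuous
    { toFun := fun x => (⟨e.proj n (e.incl α x), e.proj_mem_domain n α x⟩ :
        (e.fracPow α).domain)
      map_add' := fun x y => Subtype.ext (by simp only [map_add]; rfl)
      map_smul' := fun c x => Subtype.ext (by simp only [map_smul]; rfl) } 1 (by
    intro x
    rw [one_mul, HFrac.norm_def, HFrac.norm_def]
    refine le_of_sq_le_sq ?_ (norm_nonneg _)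
    rw [e.norm_sq_eq, e.norm_sq_eq]
    refine (e.summable_sq _).tsum_le_tsum (fun j => ?_) (e.summable_sq _)
    refine pow_le_pow_left₀ (norm_nonneg _) ?_ 2
    change ‖e.ψ.repr (e.fracPow α _) j‖ ≤ ‖e.ψ.repr (e.fracPow α _) j‖
    refine (congrArg norm (e.repr_fracPow α _ j)).trans_le
      (le_trans ?_ (congrArg norm (e.repr_fracPow α x j)).ge)
    rw [norm_mul, norm_mul]
    refine mul_le_mul_of_nonneg_left ?_ (norm_nonneg _)
    change ‖⟪e.ψ j, e.proj n (e.incl α x)⟫_𝕜‖ ≤ ‖⟪e.ψ j, e.incl α x⟫_𝕜‖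
    rw [e.inner_proj]
    split_ifs
    · exact le_rfl
    · simp)

theorem incl_projFrac (n : ℕ) (α : ℝ) (x : e.HFrac α) :
    e.incl α (e.projFrac n α x) = e.proj n (e.incl α x) := rfl

end EigenSystem

/-! ### Approximate solutions -/

variable [NormedSpace ℝ H] {A : H →ₗ.[𝕜] H} {e : EigenSystem A} {α : ℝ} {G : TimeGrid}

/-- `s ↦ 𝔉_n(s, y_s) = 𝔉(s, P^n y_s)` (intended for `s ∈ [0, T]`; extended by constants outside). -/
def forcing (F : Icc 0 G.T → HistSpace 𝕜 (e.HFrac α) G → H) (n : ℕ)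
    (y : SolSpace 𝕜 (e.HFrac α) G) : ℝ → H :=
  IccExtend G.T_pos.le fun s => F s (FinPCSpace.map (e.projFrac n α) (y.hist s))

/-- `y ∈ PC_T` solves the `n`-th approximate integral equation:
* `y(t) = χ(t)` on `[-τ, 0]`;
* `y(t) = S(t) χ(0) + ∫₀ᵗ S(t - s) 𝔉(s, P^n y_s) ds` on `[0, ρ₁]`;
* `y(t) = h_i(t, P^n y(ρ_i⁻))` on `(ρ_i, ς_i]`, `1 ≤ i ≤ q`;
* `y(t) = S(t - ς_i) h_i(ς_i, P^n y(ρ_i⁻)) + ∫_{ς_i}^t S(t - s) 𝔉(s, P^n y_s) ds` on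
  `(ς_i, ρ_{i+1}]`, `1 ≤ i ≤ q`.
The integrals are required to exist as Bochner integrals in `H`. As `y` is left-continuous,
`y(ρ_i⁻) = y(ρ_i)`. -/
structure IsApproxSolution (S : ℝ → H →L[𝕜] H)
    (F : Icc 0 G.T → HistSpace 𝕜 (e.HFrac α) G → H)
    (h : ℕ → ℝ → e.HFrac α → e.HFrac α) (χ : HistSpace 𝕜 (e.HFrac α) G) (n : ℕ)
    (y : SolSpace 𝕜 (e.HFrac α) G) : Prop where
  initial : ∀ t ∈ Icc (-G.τ) 0, y.eval t = χ.eval t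
  integrable : ∀ i ≤ G.q, ∀ t ∈ Icc (G.ς i) (G.ρ (i + 1)),
    IntervalIntegrable (fun s => S (t - s) (forcing F n y s)) volume (G.ς i) t
  first : ∀ t ∈ Icc 0 (G.ρ 1), e.incl α (y.eval t) =
    S t (e.incl α (χ.eval 0)) + ∫ s in (0 : ℝ)..t, S (t - s) (forcing F n y s)
  impulse : ∀ i, 1 ≤ i → i ≤ G.q → ∀ t ∈ Ioc (G.ρ i) (G.ς i),
    y.eval t = h i t (e.projFrac n α (y.eval (G.ρ i)))
  later : ∀ i, 1 ≤ i → i ≤ G.q → ∀ t ∈ Ioc (G.ς i) (G.ρ (i + 1)), e.incl α (y.eval t) =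
    S (t - G.ς i) (e.incl α (h i (G.ς i) (e.projFrac n α (y.eval (G.ρ i)))))
      + ∫ s in (G.ς i)..t, S (t - s) (forcing F n y s)

end Operator

end FaedoGalerkin

end

/-!
The approximate solutions are controlled by two quantities: the differences `y n - y m` and the
Galerkin tails `y n - P^n (y n)`, both measured uniformly in time in the norm of `H_α`. They suffice
because `P^n y_n - P^m y_m = (y_n - y_m) - (y_n - P^n y_n) + (y_m - P^m y_m)`, so that the forcing
terms and the impulses of two approximations differ by at most a Lipschitz constant times these
quantities.

The tails of a sequence that is uniformly Cauchy on `[-τ, a]` vanish uniformly there, because the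
values of one piecewise continuous function cluster at finitely many points and `P^n → 1` strongly
on `H_α` (`UniformCauchyUpTo.tailsVanishUpTo`). Hence the impulses carry the Cauchy property from
`ρ_i` to `ς_i` (`UniformCauchyUpTo.impulse`).

Between `ς_i` and `ρ_{i+1}` each `y n` is the mild solution starting from its own value at `ς_i`.
The semigroup acts diagonally on the eigenvectors (`EigenSystem.inner_semigroup`), so that
`A^β S(r)` has norm at most `r ^ (-β)` for `0 ≤ β ≤ 1`. With `α < β < 1` the convolution with a
bounded forcing term is bounded in `H_β`, and its tails in `H_α` are `O(lam n ^ (α - β))`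
(`EigenSystem.norm_sub_projFrac_le_of_incl_eq_integral`). With `β = α` and a norm weighted in time
by `exp (-κ t)`, `κ` large, the convolution is a contraction up to the tails, and the differences
are small as well (`UniformCauchyUpTo.of_mild`). Induction along the time grid gives the Cauchy
property on `[-τ, T]`, and the limit exists because `H_α`, and with it the space of piecewise
continuous functions, is complete.
-/

open Set Filter Topology MeasureTheory
open scoped InnerProductSpace ENNReal NNReal

namespace FaedoGalerkin


/-! ### The semigroup acts diagonally -/

section Semigroup

variable {𝕜 : Type*} [RCLike 𝕜] {H : Type*} [NormedAddCommGroup H] [InnerProductSpace 𝕜 H]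

namespace IsSemigroupGeneratedBy

variable {S : ℝ → H →L[𝕜] H} {B : H →ₗ.[𝕜] H}

theorem tendsto_nhdsGE_zero (hS : IsSemigroupGeneratedBy S B) (x : H) :
    Tendsto (fun t => S t x) (𝓝[≥] 0) (𝓝 x) := by
  have h : 𝓝[≥] (0 : ℝ) = 𝓝[{0}] 0 ⊔ 𝓝[>] 0 := by
    rw [← nhdsWithin_union]
    congr 1
    ext t
    simp [le_iff_eq_or_lt, eq_comm]
  rw [h]
  refine Tendsto.sup ?_ (hS.tendsto_zero x)
  rw [nhdsWithin_singleton, tendsto_pure_left]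
  intro s hs
  rw [hS.map_zero]
  exact mem_of_mem_nhds hs

theorem exists_bound_near_zero [CompleteSpace H] (hS : IsSemigroupGeneratedBy S B) :
    ∃ δ > 0, ∃ M : ℝ, ∀ t ∈ Icc 0 δ, ‖S t‖ ≤ M := by
  by_contra! hcon
  choose t ht hM using fun n : ℕ =>
    hcon (1 / ((n : ℝ) + 1)) Nat.one_div_pos_of_nat (n : ℝ)
  have ht0 : Tendsto t atTop (𝓝[≥] 0) := by
    refine tendsto_nhdsWithin_iff.2 ⟨?_, Eventually.of_forall fun n => (ht n).1⟩
    exact squeeze_zero (fun n => (ht n).1) (fun n => (ht n).2)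
      tendsto_one_div_add_atTop_nhds_zero_nat
  obtain ⟨C, hC⟩ := banach_steinhaus (g := fun n => S (t n)) fun x => by
    obtain ⟨C, hC⟩ := ((hS.tendsto_nhdsGE_zero x).comp ht0).norm.bddAbove_range
    exact ⟨C, fun n => hC ⟨n, rfl⟩⟩
  obtain ⟨n, hn⟩ := exists_nat_gt C
  exact absurd (hC n) (not_le.2 (hn.trans (hM n)))

theorem map_nsmul (hS : IsSemigroupGeneratedBy S B) {t : ℝ} (ht : 0 ≤ t) (n : ℕ) :
    S (n * t) = S t ^ n := by
  induction n with
  | zero => simpa using hS.map_zero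
  | succ n ih =>
    rw [pow_succ, ← ih, ← hS.map_add _ _ (by positivity) ht]
    congr 1
    push_cast
    ring

theorem exists_bound [CompleteSpace H] (hS : IsSemigroupGeneratedBy S B) (b : ℝ) :
    ∃ M : ℝ, ∀ t ∈ Icc 0 b, ‖S t‖ ≤ M := by
  obtain ⟨δ, hδ, M, hM⟩ := hS.exists_bound_near_zero
  obtain ⟨n, hn⟩ := exists_nat_gt (b / δ)
  refine ⟨M ^ (n + 1), fun t ht => ?_⟩
  have hn0 : (0 : ℝ) < (n + 1 : ℕ) := by positivity
  have h0 : 0 ≤ t / (n + 1 : ℕ) := div_nonneg ht.1 hn0.le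
  have h1 : t / (n + 1 : ℕ) ≤ δ := by
    rw [div_le_iff₀ hn0]
    rw [div_lt_iff₀ hδ] at hn
    push_cast
    nlinarith [ht.2]
  have h2 := hS.map_nsmul h0 (n + 1)
  rw [mul_div_cancel₀ _ hn0.ne'] at h2
  rw [h2]
  exact (norm_pow_le' _ n.succ_pos).trans (pow_le_pow_left₀ (norm_nonneg _) (hM _ ⟨h0, h1⟩) _)

theorem continuousOn [CompleteSpace H] (hS : IsSemigroupGeneratedBy S B) (x : H) (b : ℝ) :
    ContinuousOn (fun t => S t x) (Icc 0 b) := by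
  obtain ⟨M, hM⟩ := hS.exists_bound b
  have key : ∀ s t, 0 ≤ s → s ≤ t → t ≤ b →
      ‖S t x - S s x‖ ≤ M * ‖S |t - s| x - x‖ := by
    intro s t hs hst htb
    have h1 : S t x - S s x = S s (S |t - s| x - x) := by
      have h2 := hS.map_add s |t - s| hs (abs_nonneg _)
      rw [abs_of_nonneg (sub_nonneg.2 hst), add_sub_cancel] at h2
      rw [map_sub, abs_of_nonneg (sub_nonneg.2 hst), h2]
      rfl
    rw [h1]
    exact (S s).le_of_opNorm_le (hM s ⟨hs, hst.trans htb⟩) _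
  have key' : ∀ s ∈ Icc 0 b, ∀ t ∈ Icc 0 b, ‖S t x - S s x‖ ≤ M * ‖S |t - s| x - x‖ := by
    intro s hs t ht
    rcases le_total s t with h | h
    · exact key s t hs.1 h ht.2
    · rw [norm_sub_rev, abs_sub_comm]
      exact key t s ht.1 h hs.2
  intro s hs
  rw [ContinuousWithinAt, tendsto_iff_norm_sub_tendsto_zero]
  have h0 : Tendsto (fun t : ℝ => |t - s|) (𝓝[Icc 0 b] s) (𝓝[≥] 0) := by
    refine tendsto_nhdsWithin_iff.2 ⟨?_, Eventually.of_forall fun t => mem_Ici.2 (abs_nonneg _)⟩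
    have : Tendsto (fun t : ℝ => |t - s|) (𝓝 s) (𝓝 |s - s|) :=
      Continuous.tendsto (by fun_prop) s
    rw [sub_self, abs_zero] at this
    exact this.mono_left nhdsWithin_le_nhds
  have h1 : Tendsto (fun t : ℝ => M * ‖S |t - s| x - x‖) (𝓝[Icc 0 b] s) (𝓝 0) := by
    have := (tendsto_iff_norm_sub_tendsto_zero.1 ((hS.tendsto_nhdsGE_zero x).comp h0)).const_mul M
    rwa [mul_zero] at this
  refine squeeze_zero' (Eventually.of_forall fun t => norm_nonneg _) ?_ h1
  filter_upwards [self_mem_nhdsWithin] with t ht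
  exact key' s hs t ht

/-- On an eigenvector of the generator the semigroup acts by the exponential of the eigenvalue: the
scalar function `t ↦ exp (-μ t) ⟪z, S t x⟫` is continuous with vanishing right derivative. Testing
against `z` keeps the scalar multiplication of `ℝ` on `H` out of the argument. -/
theorem inner_apply_of_eigen [CompleteSpace H] (hS : IsSemigroupGeneratedBy S B) {x : H} {μ : ℝ}
    (hx : (x, (μ : 𝕜) • x) ∈ B.graph) (z : H) {t : ℝ} (ht : 0 ≤ t) :
    ⟪z, S t x⟫_𝕜 = ((Real.exp (μ * t) : ℝ) : 𝕜) * ⟪z, x⟫_𝕜 := by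
  have hgen := (hS.generator x _).1 hx
  have hcont : ContinuousOn (fun s => ⟪z, S s x⟫_𝕜) (Icc 0 t) :=
    continuousOn_const.inner (hS.continuousOn x t)
  have hd : ∀ s, 0 ≤ s →
      HasDerivWithinAt (fun s => ⟪z, S s x⟫_𝕜) ((μ : 𝕜) * ⟪z, S s x⟫_𝕜) (Ici s) s := by
    intro s hs
    rw [← hasDerivWithinAt_Ioi_iff_Ici, hasDerivWithinAt_iff_tendsto_slope' self_notMem_Ioi]
    have hsub : Tendsto (fun u : ℝ => u - s) (𝓝[>] s) (𝓝[>] 0) := by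
      refine tendsto_nhdsWithin_iff.2 ⟨?_, ?_⟩
      · have : Tendsto (fun u : ℝ => u - s) (𝓝 s) (𝓝 (s - s)) :=
          Continuous.tendsto (by fun_prop) s
        rw [sub_self] at this
        exact this.mono_left nhdsWithin_le_nhds
      · filter_upwards [self_mem_nhdsWithin] with u hu
        exact mem_Ioi.2 (sub_pos.2 (mem_Ioi.1 hu))
    have h1 : Tendsto (fun u : ℝ => ⟪z, S s ((((u - s)⁻¹ : ℝ) : 𝕜) • (S (u - s) x - x))⟫_𝕜)
        (𝓝[>] s) (𝓝 ⟪z, S s ((μ : 𝕜) • x)⟫_𝕜) :=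
      tendsto_const_nhds.inner (((S s).continuous.tendsto _).comp (hgen.comp hsub))
    rw [map_smul, inner_smul_right] at h1
    refine h1.congr' ?_
    filter_upwards [self_mem_nhdsWithin] with u hu
    have hu' : 0 ≤ u - s := (sub_pos.2 (mem_Ioi.1 hu)).le
    have h2 := hS.map_add s (u - s) hs hu'
    rw [add_sub_cancel] at h2
    have h3 : S s (S (u - s) x) = S u x := by rw [h2]; rfl
    rw [map_smul, map_sub, h3, inner_smul_right, inner_sub_right, slope_def_module,
      RCLike.real_smul_eq_coe_mul]
  have hexp : ∀ s, HasDerivAt (fun s : ℝ => ((Real.exp (-(μ * s)) : ℝ) : 𝕜))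
      ((-(μ * Real.exp (-(μ * s))) : ℝ) : 𝕜) s := by
    intro s
    have h1 : HasDerivAt (fun s : ℝ => Real.exp (-(μ * s))) (-(μ * Real.exp (-(μ * s)))) s :=
      ((hasDerivAt_id' s).const_mul μ).fun_neg.exp.congr_deriv (by ring)
    exact (RCLike.ofRealCLM (K := 𝕜)).hasFDerivAt.comp_hasDerivAt s h1
  have hconst := constant_of_has_deriv_right_zero
    (f := fun s : ℝ => ((Real.exp (-(μ * s)) : ℝ) : 𝕜) * ⟪z, S s x⟫_𝕜) (a := 0) (b := t)
    (ContinuousOn.mul (fun s _ => (hexp s).continuousAt.continuousWithinAt) hcont)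
    (fun s hs => by
      refine ((hexp s).hasDerivWithinAt.mul (hd s hs.1)).congr_deriv ?_
      push_cast
      ring) t ⟨ht, le_rfl⟩
  simp only [mul_zero, neg_zero, Real.exp_zero, hS.map_zero, RCLike.ofReal_one, one_mul] at hconst
  change _ = ⟪z, x⟫_𝕜 at hconst
  rw [← hconst, ← mul_assoc, ← RCLike.ofReal_mul, ← Real.exp_add]
  simp

end IsSemigroupGeneratedBy

namespace EigenSystem

variable {A : H →ₗ.[𝕜] H} (e : EigenSystem A) {S : ℝ → H →L[𝕜] H}

theorem inner_semigroup [CompleteSpace H] (hS : IsSemigroupGeneratedBy S (-A)) {t : ℝ}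
    (ht : 0 ≤ t) (j : ℕ) (x : H) :
    ⟪e.ψ j, S t x⟫_𝕜 = ((Real.exp (-(e.lam j * t)) : ℝ) : 𝕜) * ⟪e.ψ j, x⟫_𝕜 := by
  have hgraph : ∀ k, (e.ψ k, ((-e.lam k : ℝ) : 𝕜) • e.ψ k) ∈ (-A).graph := by
    intro k
    rw [LinearPMap.mem_graph_iff]
    refine ⟨⟨e.ψ k, e.mem_domain k⟩, rfl, ?_⟩
    rw [LinearPMap.neg_apply]
    change -(A ⟨e.ψ k, e.mem_domain k⟩) = _
    rw [e.eigen k]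
    push_cast
    rw [neg_smul]
  have hext : (innerSL 𝕜 (e.ψ j)).comp (S t) =
      ((Real.exp (-(e.lam j * t)) : ℝ) : 𝕜) • innerSL 𝕜 (e.ψ j) := by
    refine ContinuousLinearMap.ext_on (s := range e.ψ)
      (Submodule.dense_iff_topologicalClosure_eq_top.2 e.ψ.dense_span) ?_
    rintro _ ⟨k, rfl⟩
    change ⟪e.ψ j, S t (e.ψ k)⟫_𝕜 = ((Real.exp (-(e.lam j * t)) : ℝ) : 𝕜) * ⟪e.ψ j, e.ψ k⟫_𝕜
    rw [hS.inner_apply_of_eigen (hgraph k) _ ht]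
    by_cases hjk : j = k
    · subst hjk
      rw [neg_mul]
    · rw [e.ψ.orthonormal.2 hjk, mul_zero, mul_zero]
  exact congrArg (fun L : H →L[𝕜] 𝕜 => L x) hext

end EigenSystem

end Semigroup


/-! ### The fractional power spaces -/

section FractionalSpace

variable {𝕜 : Type*} [RCLike 𝕜] {H : Type*} [NormedAddCommGroup H] [InnerProductSpace 𝕜 H]

namespace EigenSystem

variable {A : H →ₗ.[𝕜] H} (e : EigenSystem A) {α : ℝ}

theorem mem_domain_fracPow {x : H} :
    x ∈ (e.fracPow α).domain ↔
      Memℓp (fun j => ((e.lam j ^ α : ℝ) : 𝕜) * ⟪e.ψ j, x⟫_𝕜) 2 := Iff.rfl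

theorem exists_incl_eq {x : H} (hx : x ∈ (e.fracPow α).domain) :
    ∃ z : e.HFrac α, e.incl α z = x := ⟨(⟨x, hx⟩ : (e.fracPow α).domain), rfl⟩

theorem repr_powMap (x : e.HFrac α) (j : ℕ) :
    e.ψ.repr (e.powMap α x) j = ((e.lam j ^ α : ℝ) : 𝕜) * ⟪e.ψ j, e.incl α x⟫_𝕜 :=
  e.repr_fracPow α x j

theorem hFrac_norm_sq (x : e.HFrac α) :
    ‖x‖ ^ 2 = ∑' j, ‖((e.lam j ^ α : ℝ) : 𝕜) * ⟪e.ψ j, e.incl α x⟫_𝕜‖ ^ 2 := by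
  rw [HFrac.norm_def, e.norm_sq_eq]
  simp_rw [e.repr_powMap]

theorem hFrac_summable_sq (x : e.HFrac α) :
    Summable fun j => ‖((e.lam j ^ α : ℝ) : 𝕜) * ⟪e.ψ j, e.incl α x⟫_𝕜‖ ^ 2 := by
  have h := e.summable_sq (e.powMap α x)
  simp_rw [e.repr_powMap] at h
  exact h

theorem hFrac_norm_le_of_inner {x z : e.HFrac α}
    (h : ∀ j, ‖⟪e.ψ j, e.incl α x⟫_𝕜‖ ≤ ‖⟪e.ψ j, e.incl α z⟫_𝕜‖) : ‖x‖ ≤ ‖z‖ := by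
  refine le_of_sq_le_sq ?_ (norm_nonneg _)
  rw [e.hFrac_norm_sq, e.hFrac_norm_sq]
  refine (e.hFrac_summable_sq x).tsum_le_tsum (fun j => ?_) (e.hFrac_summable_sq z)
  refine pow_le_pow_left₀ (norm_nonneg _) ?_ 2
  rw [norm_mul, norm_mul]
  exact mul_le_mul_of_nonneg_left (h j) (norm_nonneg _)

theorem hFrac_norm_le_of_sum_le {x : e.HFrac α} {C : ℝ} (hC : 0 ≤ C)
    (h : ∀ s : Finset ℕ,
      ∑ j ∈ s, ‖((e.lam j ^ α : ℝ) : 𝕜) * ⟪e.ψ j, e.incl α x⟫_𝕜‖ ^ 2 ≤ C ^ 2) : ‖x‖ ≤ C := by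
  refine le_of_sq_le_sq ?_ hC
  rw [e.hFrac_norm_sq]
  exact (e.hFrac_summable_sq x).tsum_le_of_sum_le h

theorem inner_incl_projFrac (n j : ℕ) (x : e.HFrac α) :
    ⟪e.ψ j, e.incl α (e.projFrac n α x)⟫_𝕜 =
      if j ≤ n then ⟪e.ψ j, e.incl α x⟫_𝕜 else 0 := by
  rw [e.incl_projFrac, e.inner_proj]

theorem inner_incl_sub_projFrac (n j : ℕ) (x : e.HFrac α) :
    ⟪e.ψ j, e.incl α (x - e.projFrac n α x)⟫_𝕜 =
      if j ≤ n then 0 else ⟪e.ψ j, e.incl α x⟫_𝕜 := by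
  rw [map_sub, inner_sub_right, e.inner_incl_projFrac]
  split_ifs <;> simp

theorem norm_projFrac_le (n : ℕ) (x : e.HFrac α) : ‖e.projFrac n α x‖ ≤ ‖x‖ := by
  refine e.hFrac_norm_le_of_inner fun j => ?_
  rw [e.inner_incl_projFrac]
  split_ifs <;> simp

theorem norm_sub_projFrac_le (n : ℕ) (x : e.HFrac α) : ‖x - e.projFrac n α x‖ ≤ ‖x‖ := by
  refine e.hFrac_norm_le_of_inner fun j => ?_
  rw [e.inner_incl_sub_projFrac]
  split_ifs <;> simp

/-- `‖x - P^n x‖_α ^ 2` is a tail of the convergent series for `‖x‖_α ^ 2`. -/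
theorem tendsto_norm_sub_projFrac (x : e.HFrac α) :
    Tendsto (fun n => ‖x - e.projFrac n α x‖) atTop (𝓝 0) := by
  have hsum := e.hFrac_summable_sq x
  have htail := (tendsto_sum_nat_add
    (fun j => ‖((e.lam j ^ α : ℝ) : 𝕜) * ⟪e.ψ j, e.incl α x⟫_𝕜‖ ^ 2)).comp (tendsto_add_atTop_nat 1)
  have hsq : Tendsto (fun n => ‖x - e.projFrac n α x‖ ^ 2) atTop (𝓝 0) := by
    refine htail.congr fun n => ?_
    rw [e.hFrac_norm_sq, ← (e.hFrac_summable_sq _).sum_add_tsum_nat_add (n + 1),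
      Finset.sum_eq_zero, zero_add]
    · refine tsum_congr fun j => ?_
      rw [e.inner_incl_sub_projFrac, if_neg (by omega)]
    · intro j hj
      rw [e.inner_incl_sub_projFrac, if_pos (by have := Finset.mem_range.1 hj; omega)]
      simp
  have := hsq.sqrt
  simpa using this

theorem exists_powMap_eq (hα : 0 ≤ α) [CompleteSpace H] (z : H) :
    ∃ x : e.HFrac α, e.powMap α x = z := by
  -- The coefficients of `z` divided by `lam j ^ α ≥ lam 0 ^ α` are square summable.
  have hpos : ∀ j, 0 < e.lam j ^ α := fun j => Real.rpow_pos_of_pos (e.lam_pos' j) α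
  have hmem : Memℓp (fun j => (((e.lam j ^ α)⁻¹ : ℝ) : 𝕜) * e.ψ.repr z j) 2 := by
    have hz : Memℓp (fun j => (e.lam 0 ^ α)⁻¹ * ‖e.ψ.repr z j‖) 2 :=
      (lp.memℓp (e.ψ.repr z)).norm.const_mul ((e.lam 0 ^ α)⁻¹)
    refine hz.mono fun j => ?_
    rw [norm_mul, RCLike.norm_ofReal, abs_of_nonneg (inv_nonneg.2 (hpos j).le)]
    refine mul_le_mul_of_nonneg_right ?_ (norm_nonneg _)
    exact inv_anti₀ (hpos 0) (Real.rpow_le_rpow e.lam_pos.le (e.lam_mono (Nat.zero_le j)) hα)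
  have hcoef : ∀ j, ((e.lam j ^ α : ℝ) : 𝕜) * ⟪e.ψ j, e.ψ.repr.symm ⟨_, hmem⟩⟫_𝕜 =
      e.ψ.repr z j := by
    intro j
    rw [← e.ψ.repr_apply_apply, LinearIsometryEquiv.apply_symm_apply]
    change ((e.lam j ^ α : ℝ) : 𝕜) * ((((e.lam j ^ α)⁻¹ : ℝ) : 𝕜) * e.ψ.repr z j) = _
    rw [← mul_assoc, ← RCLike.ofReal_mul, mul_inv_cancel₀ (hpos j).ne', RCLike.ofReal_one, one_mul]
  have hdom : e.ψ.repr.symm ⟨_, hmem⟩ ∈ (e.fracPow α).domain := by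
    rw [e.mem_domain_fracPow]
    simp_rw [hcoef]
    exact lp.memℓp _
  refine ⟨(⟨_, hdom⟩ : (e.fracPow α).domain), e.ψ.repr.injective ?_⟩
  ext j
  exact (e.repr_powMap _ j).trans (hcoef j)

theorem isometry_powMap : Isometry (e.powMap α) :=
  AddMonoidHomClass.isometry_of_norm _ fun x => (HFrac.norm_def e x).symm

/-- `A^α` is an isometry of `H_α` onto `H`. -/
theorem completeSpace_hFrac (hα : 0 ≤ α) [CompleteSpace H] : CompleteSpace (e.HFrac α) := by
  refine (completeSpace_iff_isComplete_range e.isometry_powMap.isUniformInducing).2 ?_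
  rw [(Set.range_eq_univ (f := e.powMap α)).2 (e.exists_powMap_eq hα)]
  exact completeSpace_iff_isComplete_univ.1 inferInstance

variable {S : ℝ → H →L[𝕜] H}

/-- The semigroup leaves `H_α` invariant and is contractive there, on the tails `x - P^n x` too. -/
theorem exists_semigroup_incl [CompleteSpace H] (hS : IsSemigroupGeneratedBy S (-A)) {t : ℝ}
    (ht : 0 ≤ t) (x : e.HFrac α) : ∃ z : e.HFrac α, e.incl α z = S t (e.incl α x) ∧
      ‖z‖ ≤ ‖x‖ ∧ ∀ n, ‖z - e.projFrac n α z‖ ≤ ‖x - e.projFrac n α x‖ := by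
  have hle : ∀ j, ‖⟪e.ψ j, S t (e.incl α x)⟫_𝕜‖ ≤ ‖⟪e.ψ j, e.incl α x⟫_𝕜‖ := by
    intro j
    rw [e.inner_semigroup hS ht, norm_mul, RCLike.norm_ofReal, abs_of_pos (Real.exp_pos _)]
    refine mul_le_of_le_one_left (norm_nonneg _) (Real.exp_le_one_iff.2 ?_)
    exact neg_nonpos.2 (mul_nonneg (e.lam_pos' j).le ht)
  have hdom : S t (e.incl α x) ∈ (e.fracPow α).domain := by
    rw [e.mem_domain_fracPow]
    have hx : Memℓp (fun j => ‖((e.lam j ^ α : ℝ) : 𝕜) * ⟪e.ψ j, e.incl α x⟫_𝕜‖) 2 :=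
      (e.mem_domain_fracPow.1 x.2).norm
    refine hx.mono fun j => ?_
    rw [norm_mul, norm_mul]
    exact mul_le_mul_of_nonneg_left (hle j) (norm_nonneg _)
  obtain ⟨z, hz⟩ := e.exists_incl_eq hdom
  rw [← hz] at hle
  refine ⟨z, hz, e.hFrac_norm_le_of_inner hle, fun n => ?_⟩
  refine e.hFrac_norm_le_of_inner fun j => ?_
  rw [e.inner_incl_sub_projFrac, e.inner_incl_sub_projFrac]
  split_ifs
  · exact le_rfl
  · exact hle j

end EigenSystem

end FractionalSpace


/-! ### Smoothing by the convolution with the semigroup -/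

theorem intervalIntegrable_sub_rpow_mul_exp {β : ℝ} (hβ : β < 1) (κ a t : ℝ) :
    IntervalIntegrable (fun s => (t - s) ^ (-β) * Real.exp (κ * s)) volume a t := by
  have h1 : IntervalIntegrable (fun u : ℝ => u ^ (-β)) volume (t - a) (t - t) :=
    intervalIntegral.intervalIntegrable_rpow' (by linarith)
  have h2 := h1.comp_sub_left t
  simp only [sub_sub_cancel] at h2
  exact h2.mul_continuousOn (by fun_prop)

theorem integral_sub_rpow_mul_exp_le {β κ a t : ℝ} (hβ : β < 1) (hκ : 0 < κ) (hat : a ≤ t) :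
    ∫ s in a..t, (t - s) ^ (-β) * Real.exp (κ * s) ≤
      Real.exp (κ * t) * ((1 / κ) ^ (1 - β) * Real.Gamma (1 - β)) := by
  have hβ' : 0 < 1 - β := sub_pos.2 hβ
  have hkey := Real.integral_rpow_mul_exp_neg_mul_Ioi hβ' hκ
  have hint : IntegrableOn (fun x : ℝ => x ^ ((1 - β) - 1) * Real.exp (-(κ * x))) (Ioi 0) :=
    .of_integral_ne_zero (by
      rw [hkey]
      exact (mul_pos (Real.rpow_pos_of_pos (by positivity) _) (Real.Gamma_pos_of_pos hβ')).ne')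
  have h1 : ∫ s in a..t, (t - s) ^ (-β) * Real.exp (κ * s) =
      ∫ u in (0 : ℝ)..(t - a),
        Real.exp (κ * t) * (u ^ ((1 - β) - 1) * Real.exp (-(κ * u))) := by
    have h2 := intervalIntegral.integral_comp_sub_left (a := a) (b := t)
      (fun u : ℝ => Real.exp (κ * t) * (u ^ ((1 - β) - 1) * Real.exp (-(κ * u)))) t
    rw [sub_self] at h2
    rw [← h2]
    refine intervalIntegral.integral_congr fun s _ => ?_
    have h3 : Real.exp (κ * s) = Real.exp (κ * t) * Real.exp (-(κ * (t - s))) := by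
      rw [← Real.exp_add]
      congr 1
      ring
    simp only [h3, show (1 - β) - 1 = -β by ring]
    ring
  rw [h1, intervalIntegral.integral_const_mul, ← hkey,
    intervalIntegral.integral_of_le (sub_nonneg.2 hat)]
  refine mul_le_mul_of_nonneg_left ?_ (Real.exp_pos _).le
  refine setIntegral_mono_set hint ?_ Ioc_subset_Ioi_self.eventuallyLE
  filter_upwards [ae_restrict_mem measurableSet_Ioi] with x hx
  exact mul_nonneg (Real.rpow_nonneg (mem_Ioi.1 hx).le _) (Real.exp_pos _).le

theorem rpow_mul_exp_neg_le {β l r : ℝ} (hβ0 : 0 ≤ β) (hβ1 : β ≤ 1) (hl : 0 < l) (hr : 0 < r) :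
    l ^ β * Real.exp (-(l * r)) ≤ r ^ (-β) := by
  have hlr : 0 < l * r := mul_pos hl hr
  have h1 : (l * r) ^ β ≤ Real.exp (l * r) := by
    have h2 : l * r ≤ Real.exp (l * r) := by linarith [Real.add_one_le_exp (l * r)]
    calc (l * r) ^ β ≤ (Real.exp (l * r)) ^ β := Real.rpow_le_rpow hlr.le h2 hβ0
      _ ≤ (Real.exp (l * r)) ^ (1 : ℝ) :=
        Real.rpow_le_rpow_of_exponent_le (Real.one_le_exp hlr.le) hβ1
      _ = Real.exp (l * r) := Real.rpow_one _
  rw [Real.mul_rpow hl.le hr.le] at h1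
  rw [Real.rpow_neg hr.le, Real.exp_neg, ← div_eq_mul_inv, ← one_div,
    div_le_div_iff₀ (Real.exp_pos _) (Real.rpow_pos_of_pos hr _), one_mul]
  exact h1

section Smoothing

variable {𝕜 : Type*} [RCLike 𝕜] {H : Type*} [NormedAddCommGroup H] [InnerProductSpace 𝕜 H]

namespace EigenSystem

variable {A : H →ₗ.[𝕜] H} (e : EigenSystem A) {α : ℝ} {S : ℝ → H →L[𝕜] H}

/-- The part of `A^α` that belongs to the finitely many eigenvectors `ψ j`, `j ∈ s`. It is bounded
on `H`, so that it can be interchanged with a Bochner integral. -/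
noncomputable def finPow (α : ℝ) (s : Finset ℕ) : H →L[𝕜] H :=
  ∑ j ∈ s, ((e.lam j ^ α : ℝ) : 𝕜) • (innerSL 𝕜 (e.ψ j)).smulRight (e.ψ j)

theorem finPow_apply (α : ℝ) (s : Finset ℕ) (x : H) :
    e.finPow α s x = ∑ j ∈ s, (((e.lam j ^ α : ℝ) : 𝕜) * ⟪e.ψ j, x⟫_𝕜) • e.ψ j := by
  simp [finPow, mul_smul]

theorem norm_finPow_sq (α : ℝ) (s : Finset ℕ) (x : H) :
    ‖e.finPow α s x‖ ^ 2 = ∑ j ∈ s, ‖((e.lam j ^ α : ℝ) : 𝕜) * ⟪e.ψ j, x⟫_𝕜‖ ^ 2 := by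
  rw [finPow_apply, ← RCLike.ofReal_inj (K := 𝕜), RCLike.ofReal_pow,
    ← inner_self_eq_norm_sq_to_K, e.ψ.orthonormal.inner_sum, RCLike.ofReal_sum]
  refine Finset.sum_congr rfl fun j _ => ?_
  rw [RCLike.conj_mul, RCLike.ofReal_pow]

theorem norm_finPow_semigroup_le [CompleteSpace H] (hS : IsSemigroupGeneratedBy S (-A))
    {β c : ℝ} (hβ0 : 0 ≤ β) (hβ1 : β ≤ 1) (hc : 0 ≤ c) {s : Finset ℕ}
    (hs : ∀ j ∈ s, e.lam j ^ α ≤ c * e.lam j ^ β) {r : ℝ} (hr : 0 < r) (x : H) :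
    ‖e.finPow α s (S r x)‖ ≤ c * r ^ (-β) * ‖x‖ := by
  have hcr : 0 ≤ c * r ^ (-β) := mul_nonneg hc (Real.rpow_nonneg hr.le _)
  refine le_of_sq_le_sq ?_ (mul_nonneg hcr (norm_nonneg _))
  rw [norm_finPow_sq, mul_pow]
  calc ∑ j ∈ s, ‖((e.lam j ^ α : ℝ) : 𝕜) * ⟪e.ψ j, S r x⟫_𝕜‖ ^ 2
      ≤ ∑ j ∈ s, (c * r ^ (-β)) ^ 2 * ‖⟪e.ψ j, x⟫_𝕜‖ ^ 2 := by
        refine Finset.sum_le_sum fun j hj => ?_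
        rw [← mul_pow]
        refine pow_le_pow_left₀ (norm_nonneg _) ?_ 2
        have hl := Real.rpow_pos_of_pos (e.lam_pos' j) α
        rw [e.inner_semigroup hS hr.le, ← mul_assoc, ← RCLike.ofReal_mul, norm_mul,
          RCLike.norm_ofReal, abs_of_pos (mul_pos hl (Real.exp_pos _))]
        refine mul_le_mul_of_nonneg_right ?_ (norm_nonneg _)
        calc e.lam j ^ α * Real.exp (-(e.lam j * r))
            ≤ c * e.lam j ^ β * Real.exp (-(e.lam j * r)) :=
              mul_le_mul_of_nonneg_right (hs j hj) (Real.exp_pos _).le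
          _ = c * (e.lam j ^ β * Real.exp (-(e.lam j * r))) := mul_assoc _ _ _
          _ ≤ c * r ^ (-β) :=
              mul_le_mul_of_nonneg_left (rpow_mul_exp_neg_le hβ0 hβ1 (e.lam_pos' j) hr) hc
    _ = (c * r ^ (-β)) ^ 2 * ∑ j ∈ s, ‖⟪e.ψ j, x⟫_𝕜‖ ^ 2 := by rw [Finset.mul_sum]
    _ ≤ (c * r ^ (-β)) ^ 2 * ‖x‖ ^ 2 :=
        mul_le_mul_of_nonneg_left (e.ψ.orthonormal.sum_inner_products_le x) (sq_nonneg _)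

variable [NormedSpace ℝ H]

theorem norm_finPow_integral_le [CompleteSpace H] (hS : IsSemigroupGeneratedBy S (-A))
    {β c : ℝ} (hβ0 : 0 ≤ β) (hβ1 : β < 1) (hc : 0 ≤ c) {s : Finset ℕ}
    (hs : ∀ j ∈ s, e.lam j ^ α ≤ c * e.lam j ^ β) {f : ℝ → H} {a t K κ : ℝ} (hat : a ≤ t)
    (hκ : 0 < κ) (hK : 0 ≤ K)
    (hint : IntervalIntegrable (fun u => S (t - u) (f u)) volume a t)
    (hf : ∀ u ∈ Icc a t, ‖f u‖ ≤ K * Real.exp (κ * u)) :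
    ‖e.finPow α s (∫ u in a..t, S (t - u) (f u))‖ ≤
      c * (K * (Real.exp (κ * t) * ((1 / κ) ^ (1 - β) * Real.Gamma (1 - β)))) := by
  rw [← (e.finPow α s).intervalIntegral_comp_comm hint]
  calc ‖∫ u in a..t, e.finPow α s (S (t - u) (f u))‖
      ≤ ∫ u in a..t, c * K * ((t - u) ^ (-β) * Real.exp (κ * u)) := by
        refine intervalIntegral.norm_integral_le_of_norm_le hat ?_
          ((intervalIntegrable_sub_rpow_mul_exp hβ1 κ a t).const_mul _)
        -- The kernel is singular at `u = t`, a null set.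
        have hne : ∀ᵐ u : ℝ, u ≠ t := by simp [ae_iff, measure_singleton]
        filter_upwards [hne] with u hut hu
        have hr : 0 < t - u := sub_pos.2 (lt_of_le_of_ne hu.2 hut)
        have hcr : 0 ≤ c * (t - u) ^ (-β) := mul_nonneg hc (Real.rpow_nonneg hr.le _)
        calc ‖e.finPow α s (S (t - u) (f u))‖ ≤ c * (t - u) ^ (-β) * ‖f u‖ :=
              e.norm_finPow_semigroup_le hS hβ0 hβ1.le hc hs hr _
          _ ≤ c * (t - u) ^ (-β) * (K * Real.exp (κ * u)) :=
              mul_le_mul_of_nonneg_left (hf u ⟨hu.1.le, hu.2⟩) hcr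
          _ = _ := by ring
    _ = c * K * ∫ u in a..t, (t - u) ^ (-β) * Real.exp (κ * u) :=
        intervalIntegral.integral_const_mul _ _
    _ ≤ c * K * (Real.exp (κ * t) * ((1 / κ) ^ (1 - β) * Real.Gamma (1 - β))) :=
        mul_le_mul_of_nonneg_left (integral_sub_rpow_mul_exp_le hβ1 hκ hat) (mul_nonneg hc hK)
    _ = _ := by ring

theorem norm_le_of_incl_eq_integral [CompleteSpace H] (hS : IsSemigroupGeneratedBy S (-A))
    (hα0 : 0 ≤ α) (hα1 : α < 1) {f : ℝ → H} {a t K κ : ℝ} (hat : a ≤ t)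
    (hκ : 0 < κ) (hK : 0 ≤ K)
    (hint : IntervalIntegrable (fun u => S (t - u) (f u)) volume a t)
    (hf : ∀ u ∈ Icc a t, ‖f u‖ ≤ K * Real.exp (κ * u)) {v : e.HFrac α}
    (hv : e.incl α v = ∫ u in a..t, S (t - u) (f u)) :
    ‖v‖ ≤ K * (Real.exp (κ * t) * ((1 / κ) ^ (1 - α) * Real.Gamma (1 - α))) := by
  have hΓ := Real.Gamma_pos_of_pos (sub_pos.2 hα1)
  refine e.hFrac_norm_le_of_sum_le (by positivity) fun s => ?_
  rw [← e.norm_finPow_sq, hv]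
  refine pow_le_pow_left₀ (norm_nonneg _) ?_ 2
  refine (e.norm_finPow_integral_le hS hα0 hα1 zero_le_one (fun j _ => (one_mul _).ge) hat hκ hK
    hint hf).trans_eq (one_mul _)

/-- The convolution is bounded in `H_β` for every `β < 1`, which makes its tails small in `H_α`,
`α ≤ β`, at a rate that depends only on the bound for the forcing term. -/
theorem norm_sub_projFrac_le_of_incl_eq_integral [CompleteSpace H]
    (hS : IsSemigroupGeneratedBy S (-A)) {β : ℝ} (hβ0 : 0 ≤ β) (hαβ : α ≤ β) (hβ1 : β < 1)
    {f : ℝ → H} {a t K κ : ℝ} (hat : a ≤ t) (hκ : 0 < κ) (hK : 0 ≤ K)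
    (hint : IntervalIntegrable (fun u => S (t - u) (f u)) volume a t)
    (hf : ∀ u ∈ Icc a t, ‖f u‖ ≤ K * Real.exp (κ * u)) {v : e.HFrac α}
    (hv : e.incl α v = ∫ u in a..t, S (t - u) (f u)) (n : ℕ) :
    ‖v - e.projFrac n α v‖ ≤ e.lam n ^ (α - β) *
      (K * (Real.exp (κ * t) * ((1 / κ) ^ (1 - β) * Real.Gamma (1 - β)))) := by
  have hΓ := Real.Gamma_pos_of_pos (sub_pos.2 hβ1)
  have hn := Real.rpow_pos_of_pos (e.lam_pos' n) (α - β)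
  refine e.hFrac_norm_le_of_sum_le (by positivity) fun s => ?_
  have hsum : ∑ j ∈ s, ‖((e.lam j ^ α : ℝ) : 𝕜) *
      ⟪e.ψ j, e.incl α (v - e.projFrac n α v)⟫_𝕜‖ ^ 2 =
      ‖e.finPow α (s.filter fun j => n < j) (e.incl α v)‖ ^ 2 := by
    rw [e.norm_finPow_sq, Finset.sum_filter]
    refine Finset.sum_congr rfl fun j _ => ?_
    rw [e.inner_incl_sub_projFrac]
    by_cases hj : j ≤ n
    · rw [if_pos hj, if_neg (not_lt.2 hj)]
      simp
    · rw [if_neg hj, if_pos (not_le.1 hj)]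
  rw [hsum, hv]
  refine pow_le_pow_left₀ (norm_nonneg _) ?_ 2
  refine e.norm_finPow_integral_le hS hβ0 hβ1 hn.le (fun j hj => ?_) hat hκ hK hint hf
  have hnj : n ≤ j := (Finset.mem_filter.1 hj).2.le
  calc e.lam j ^ α = e.lam j ^ (α - β) * e.lam j ^ β := by
        rw [← Real.rpow_add (e.lam_pos' j), sub_add_cancel]
    _ ≤ e.lam n ^ (α - β) * e.lam j ^ β :=
        mul_le_mul_of_nonneg_right
          (Real.rpow_le_rpow_of_nonpos (e.lam_pos' n) (e.lam_mono hnj) (sub_nonpos.2 hαβ))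
          (Real.rpow_nonneg (e.lam_pos' j).le _)

end EigenSystem

end Smoothing


/-! ### Piecewise continuous functions -/

section PiecewiseContinuous

variable {𝕜 : Type*} [RCLike 𝕜] {E : Type*} [NormedAddCommGroup E] [NormedSpace 𝕜 E] {a b : ℝ}

theorem nhds_eq_nhdsLE_sup_nhdsGT {X : Type*} [TopologicalSpace X] [LinearOrder X] (t : X) :
    𝓝 t = 𝓝[≤] t ⊔ 𝓝[>] t := by
  rw [← nhdsWithin_union, Iic_union_Ioi, nhdsWithin_univ]

/-- The values of a piecewise continuous function on a compact interval cluster at finitely many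
points, on which the quantities `Φ n` get small simultaneously. -/
theorem IsPiecewiseCont.eventually_forall_le {J : Set ℝ} {f : Icc a b → E}
    (hf : IsPiecewiseCont J f) {Φ : ℕ → E → ℝ} (hΦ : ∀ x, Tendsto (fun n => Φ n x) atTop (𝓝 0))
    (hlip : ∀ n x z, Φ n x ≤ Φ n z + ‖x - z‖) {ε : ℝ} (hε : 0 < ε) :
    ∀ᶠ n in atTop, ∀ t, Φ n (f t) ≤ ε := by
  have key : ∀ (l : E) (F : Filter (Icc a b)), Tendsto f F (𝓝 l) →
      ∃ U ∈ F, ∀ᶠ n in atTop, ∀ t ∈ U, Φ n (f t) ≤ ε := by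
    intro l F hF
    refine ⟨_, hF (Metric.ball_mem_nhds l (half_pos hε)), ?_⟩
    filter_upwards [(hΦ l).eventually_lt_const (half_pos hε)] with n hn t ht
    have h1 : ‖f t - l‖ < ε / 2 := mem_ball_iff_norm.1 ht
    linarith [hlip n (f t) l]
  have h := isCompact_univ.induction_on (X := Icc a b)
    (p := fun U => ∀ᶠ n in atTop, ∀ t ∈ U, Φ n (f t) ≤ ε)
    (by simp) (fun U V hUV hV => hV.mono fun n hn t ht => hn t (hUV ht))
    (fun U V hU hV => by
      filter_upwards [hU, hV] with n h1 h2 t ht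
      exact ht.elim (h1 t) (h2 t))
    (fun t _ => by
      obtain ⟨l, hl⟩ := hf.right t
      obtain ⟨U, hU, hU'⟩ := key _ _ (hf.left t)
      obtain ⟨V, hV, hV'⟩ := key _ _ hl
      refine ⟨U ∪ V, ?_, ?_⟩
      · rw [nhdsWithin_univ, nhds_eq_nhdsLE_sup_nhdsGT]
        exact union_mem_sup hU hV
      · filter_upwards [hU', hV'] with n h1 h2 t ht
        exact ht.elim (h1 t) (h2 t))
  exact h.mono fun n hn t => hn t (mem_univ t)

theorem tendsto_of_forall_exists_close {X : Type*} {F : Filter X} {f : X → E} {l : E}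
    (h : ∀ ε > 0, ∃ g : X → E, ∃ m : E, (∀ x, ‖f x - g x‖ ≤ ε) ∧ ‖l - m‖ ≤ ε ∧
      Tendsto g F (𝓝 m)) : Tendsto f F (𝓝 l) := by
  rw [Metric.tendsto_nhds]
  intro ε hε
  obtain ⟨g, m, hg, hm, hgm⟩ := h (ε / 4) (by positivity)
  filter_upwards [Metric.tendsto_nhds.1 hgm (ε / 4) (by positivity)] with x hx
  rw [dist_eq_norm] at hx ⊢
  have h1 : f x - l = (f x - g x) + (g x - m) - (l - m) := by abel
  rw [h1]
  linarith [norm_sub_le ((f x - g x) + (g x - m)) (l - m), norm_add_le (f x - g x) (g x - m), hg x]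

theorem cauchy_map_of_forall_exists_close {X : Type*} {F : Filter X} [F.NeBot] {f : X → E}
    (h : ∀ ε > 0, ∃ g : X → E, ∃ m : E, (∀ x, ‖f x - g x‖ ≤ ε) ∧ Tendsto g F (𝓝 m)) :
    Cauchy (map f F) := by
  rw [Metric.cauchy_iff]
  refine ⟨inferInstance, fun ε hε => ?_⟩
  obtain ⟨g, m, hg, hgm⟩ := h (ε / 4) (by positivity)
  refine ⟨_, image_mem_map (Metric.tendsto_nhds.1 hgm (ε / 4) (by positivity)), ?_⟩
  rintro _ ⟨x, hx, rfl⟩ _ ⟨z, hz, rfl⟩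
  have hx' : dist (g x) m < ε / 4 := hx
  have hz' : dist (g z) m < ε / 4 := hz
  rw [dist_eq_norm] at hx' hz' ⊢
  have h1 : f x - f z = ((f x - g x) + (g x - m)) - ((f z - g z) + (g z - m)) := by abel
  rw [h1]
  linarith [norm_sub_le ((f x - g x) + (g x - m)) ((f z - g z) + (g z - m)),
    norm_add_le (f x - g x) (g x - m), norm_add_le (f z - g z) (g z - m), hg x, hg z]

theorem IsPiecewiseCont.of_forall_exists_close [CompleteSpace E] {J : Set ℝ} {f : Icc a b → E}
    (h : ∀ ε > 0, ∃ g : Icc a b → E, IsPiecewiseCont J g ∧ ∀ t, ‖f t - g t‖ ≤ ε) :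
    IsPiecewiseCont J f := by
  refine ⟨fun t ht => tendsto_of_forall_exists_close fun ε hε => ?_,
    fun t => tendsto_of_forall_exists_close fun ε hε => ?_, fun t => ?_⟩
  · obtain ⟨g, hg, hfg⟩ := h ε hε
    exact ⟨g, g t, hfg, hfg t, hg.continuousAt t ht⟩
  · obtain ⟨g, hg, hfg⟩ := h ε hε
    exact ⟨g, g t, hfg, hfg t, hg.left t⟩
  · rcases (𝓝[>] t).eq_or_neBot with hbot | hne
    · exact ⟨0, by rw [hbot]; exact tendsto_bot⟩
    · refine cauchy_map_iff_exists_tendsto.1 (cauchy_map_of_forall_exists_close fun ε hε => ?_)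
      obtain ⟨g, hg, hfg⟩ := h ε hε
      obtain ⟨l, hl⟩ := hg.right t
      exact ⟨g, l, hfg, hl⟩

variable (𝕜) in
theorem completeSpace_pcSpace [CompleteSpace E] (J : Set ℝ) :
    CompleteSpace (PCSpace 𝕜 E a b J) := by
  have hcl : IsClosed (PCSpace 𝕜 E a b J : Set (lp (fun _ : Icc a b => E) ∞)) := by
    refine isClosed_of_closure_subset fun f hf => ?_
    refine IsPiecewiseCont.of_forall_exists_close fun ε hε => ?_
    obtain ⟨g, hg, hfg⟩ := Metric.mem_closure_iff.1 hf ε hε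
    refine ⟨g, hg, fun t => ?_⟩
    rw [dist_eq_norm] at hfg
    exact (lp.norm_apply_le_norm ENNReal.top_ne_zero (f - g) t).trans hfg.le
  exact hcl.completeSpace_coe

variable {G : TimeGrid}

theorem SolSpace.eval_of_mem (y : SolSpace 𝕜 E G) {t : ℝ} (ht : t ∈ Icc (-G.τ) G.T) :
    y.eval t = (y : lp (fun _ : Icc (-G.τ) G.T => E) ∞) ⟨t, ht⟩ := by
  rw [SolSpace.eval, projIcc_of_mem _ ht]

theorem SolSpace.norm_eval_le (y : SolSpace 𝕜 E G) (t : ℝ) : ‖y.eval t‖ ≤ ‖y‖ :=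
  lp.norm_apply_le_norm ENNReal.top_ne_zero (y : lp (fun _ : Icc (-G.τ) G.T => E) ∞) _

theorem HistSpace.norm_eval_le (x : HistSpace 𝕜 E G) (t : ℝ) : ‖x.eval t‖ ≤ ‖x‖ :=
  lp.norm_apply_le_norm ENNReal.top_ne_zero (x : lp (fun _ : Icc (-G.τ) 0 => E) ∞) _

theorem SolSpace.norm_sub_le_of_forall {y z : SolSpace 𝕜 E G} {C : ℝ} (hC : 0 ≤ C)
    (h : ∀ t ∈ Icc (-G.τ) G.T, ‖y.eval t - z.eval t‖ ≤ C) : ‖y - z‖ ≤ C := by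
  refine lp.norm_le_of_forall_le (f := ((y - z : SolSpace 𝕜 E G) :
    lp (fun _ : Icc (-G.τ) G.T => E) ∞)) hC fun t => ?_
  have := h t t.2
  rw [y.eval_of_mem t.2, z.eval_of_mem t.2] at this
  exact this

theorem norm_map_hist_le {y : SolSpace 𝕜 E G} {L : E →L[𝕜] E} {s : Icc 0 G.T} {C : ℝ}
    (hC : 0 ≤ C) (h : ∀ t ∈ Icc (-G.τ) (s : ℝ), ‖L (y.eval t)‖ ≤ C) :
    ‖FinPCSpace.map L (y.hist s)‖ ≤ C := by
  refine lp.norm_le_of_forall_le (f := ((FinPCSpace.map L (y.hist s) : HistSpace 𝕜 E G) :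
    lp (fun _ : Icc (-G.τ) 0 => E) ∞)) hC fun θ => ?_
  have hθ : (shift G s θ : ℝ) ∈ Icc (-G.τ) (s : ℝ) :=
    ⟨(shift G s θ).2.1, add_le_of_nonpos_right θ.2.2⟩
  have := h _ hθ
  rw [y.eval_of_mem (shift G s θ).2] at this
  exact this

theorem norm_map_hist_sub_map_hist_le {y z : SolSpace 𝕜 E G} {L M : E →L[𝕜] E} {s : Icc 0 G.T}
    {C : ℝ} (hC : 0 ≤ C)
    (h : ∀ t ∈ Icc (-G.τ) (s : ℝ), ‖L (y.eval t) - M (z.eval t)‖ ≤ C) :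
    ‖FinPCSpace.map L (y.hist s) - FinPCSpace.map M (z.hist s)‖ ≤ C := by
  refine lp.norm_le_of_forall_le
    (f := ((FinPCSpace.map L (y.hist s) - FinPCSpace.map M (z.hist s) : HistSpace 𝕜 E G) :
    lp (fun _ : Icc (-G.τ) 0 => E) ∞)) hC fun θ => ?_
  have hθ : (shift G s θ : ℝ) ∈ Icc (-G.τ) (s : ℝ) :=
    ⟨(shift G s θ).2.1, add_le_of_nonpos_right θ.2.2⟩
  have := h _ hθ
  rw [y.eval_of_mem (shift G s θ).2, z.eval_of_mem (shift G s θ).2] at this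
  exact this

end PiecewiseContinuous

/-! ### The time grid -/

namespace TimeGrid

variable (G : TimeGrid)

theorem ς_nonneg {i : ℕ} (hi : i ≤ G.q) : 0 ≤ G.ς i := by
  induction i with
  | zero => exact G.ς_zero.ge
  | succ k ih =>
    linarith [ih (by omega), G.ς_lt_ρ k (by omega), G.ρ_lt_ς (k + 1) (by omega) hi]

theorem ρ_succ_le_T {i : ℕ} (hi : i ≤ G.q) : G.ρ (i + 1) ≤ G.T := by
  induction hi using Nat.decreasingInduction with
  | self => exact G.ρ_last.le
  | of_succ k hk ih =>
    linarith [G.ς_lt_ρ (k + 1) (by omega), G.ρ_lt_ς (k + 1) (by omega) (by omega)]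

end TimeGrid


/-! ### Propagation of the Cauchy property along the time grid -/

/-- A quantity that improves every upper bound `M` of itself to `c + M / 2` is at most `2 * c`. -/
theorem le_two_mul_of_forall_le_add_half {X : Set ℝ} {D : ℝ → ℝ} {B c : ℝ}
    (hD : ∀ t ∈ X, 0 ≤ D t) (hB : ∀ t ∈ X, D t ≤ B)
    (h : ∀ M, 0 ≤ M → (∀ t ∈ X, D t ≤ M) → ∀ t ∈ X, D t ≤ c + M / 2) {t : ℝ} (ht : t ∈ X) :
    D t ≤ 2 * c := by
  have hbdd : BddAbove (D '' X) := ⟨B, by rintro _ ⟨s, hs, rfl⟩; exact hB s hs⟩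
  have hle : ∀ s ∈ X, D s ≤ sSup (D '' X) := fun s hs => le_csSup hbdd (mem_image_of_mem D hs)
  have h1 : sSup (D '' X) ≤ c + sSup (D '' X) / 2 := by
    refine csSup_le ⟨_, mem_image_of_mem D ht⟩ ?_
    rintro _ ⟨s, hs, rfl⟩
    exact h _ ((hD t ht).trans (hle t ht)) hle s hs
  linarith [hle t ht]

theorem exists_pos_mul_rpow_mul_Gamma_le {p : ℝ} (hp : 0 < p) (C : ℝ) :
    ∃ κ : ℝ, 0 < κ ∧ C * ((1 / κ) ^ p * Real.Gamma p) ≤ 1 / 2 := by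
  have h1 : Tendsto (fun κ : ℝ => C * ((1 / κ) ^ p * Real.Gamma p)) atTop (𝓝 0) := by
    have h2 : Tendsto (fun κ : ℝ => 1 / κ) atTop (𝓝 0) := by
      simpa only [one_div] using tendsto_inv_atTop_zero
    have h3 := ((h2.rpow_const (p := p) (Or.inr hp.le)).mul_const (Real.Gamma p)).const_mul C
    rwa [Real.zero_rpow hp.ne', zero_mul, mul_zero] at h3
  obtain ⟨κ, hκ, hκ'⟩ := ((h1.eventually_le_const (by norm_num : (0 : ℝ) < 1 / 2)).and
    (eventually_gt_atTop 0)).exists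
  exact ⟨κ, hκ', hκ⟩

section Propagation

variable {𝕜 : Type*} [RCLike 𝕜] {H : Type*} [NormedAddCommGroup H] [InnerProductSpace 𝕜 H]
  {A : H →ₗ.[𝕜] H} {e : EigenSystem A} {α : ℝ} {G : TimeGrid}

/-- The sequence `y` is uniformly Cauchy on `[-τ, a]`, in the norm of `E`. -/
def UniformCauchyUpTo {E : Type*} [NormedAddCommGroup E] [NormedSpace 𝕜 E]
    (y : ℕ → SolSpace 𝕜 E G) (a : ℝ) : Prop :=
  ∀ ε > 0, ∀ᶠ p : ℕ × ℕ in atTop ×ˢ atTop,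
    ∀ t ∈ Icc (-G.τ) a, ‖(y p.1).eval t - (y p.2).eval t‖ ≤ ε

theorem UniformCauchyUpTo.exists_forall {E : Type*} [NormedAddCommGroup E] [NormedSpace 𝕜 E]
    {y : ℕ → SolSpace 𝕜 E G} {a : ℝ} (hy : UniformCauchyUpTo y a) {ε : ℝ} (hε : 0 < ε) :
    ∃ N, ∀ n ≥ N, ∀ m ≥ N, ∀ t ∈ Icc (-G.τ) a, ‖(y n).eval t - (y m).eval t‖ ≤ ε := by
  have h := hy ε hε
  rw [prod_atTop_atTop_eq] at h
  exact eventually_atTop_prod_self'.1 h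

/-- The Galerkin tails `y n - P^n (y n)` tend to `0` uniformly on `[-τ, a]`, in the norm of `H_α`. -/
def TailsVanishUpTo (y : ℕ → SolSpace 𝕜 (e.HFrac α) G) (a : ℝ) : Prop :=
  ∀ ε > 0, ∀ᶠ n in atTop,
    ∀ t ∈ Icc (-G.τ) a, ‖(y n).eval t - e.projFrac n α ((y n).eval t)‖ ≤ ε

theorem norm_sub_projFrac_le_add (n : ℕ) (x z : e.HFrac α) :
    ‖x - e.projFrac n α x‖ ≤ ‖z - e.projFrac n α z‖ + ‖x - z‖ := by
  have h : x - e.projFrac n α x =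
      (z - e.projFrac n α z) + ((x - z) - e.projFrac n α (x - z)) := by
    rw [map_sub]
    abel
  rw [h]
  exact (norm_add_le _ _).trans (add_le_add_right (e.norm_sub_projFrac_le n _) _)

theorem norm_projFrac_sub_projFrac_le (n m : ℕ) (x z : e.HFrac α) :
    ‖e.projFrac n α x - e.projFrac m α z‖ ≤
      ‖x - z‖ + ‖x - e.projFrac n α x‖ + ‖z - e.projFrac m α z‖ := by
  have h : e.projFrac n α x - e.projFrac m α z =
      (x - z) - (x - e.projFrac n α x) + (z - e.projFrac m α z) := by abel
  rw [h]
  exact (norm_add_le _ _).trans (add_le_add_left (norm_sub_le _ _) _)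

/-- The tails of a single member of the sequence vanish uniformly, by compactness; the members far
out are uniformly close to it. -/
theorem UniformCauchyUpTo.tailsVanishUpTo {y : ℕ → SolSpace 𝕜 (e.HFrac α) G} {a : ℝ}
    (ha : a ≤ G.T) (hy : UniformCauchyUpTo y a) : TailsVanishUpTo y a := by
  intro ε hε
  obtain ⟨N, hN⟩ := hy.exists_forall (half_pos hε)
  have h1 := IsPiecewiseCont.eventually_forall_le (y N).2
    (Φ := fun n x => ‖x - e.projFrac n α x‖) e.tendsto_norm_sub_projFrac
    norm_sub_projFrac_le_add (half_pos hε)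
  filter_upwards [h1, eventually_ge_atTop N] with n hn hNn t ht
  have h2 : ‖(y N).eval t - e.projFrac n α ((y N).eval t)‖ ≤ ε / 2 := by
    rw [(y N).eval_of_mem ⟨ht.1, ht.2.trans ha⟩]
    exact hn _
  have h3 := norm_sub_projFrac_le_add n ((y n).eval t) ((y N).eval t)
  linarith [hN n hNn N le_rfl t ht]

theorem UniformCauchyUpTo.extend {E : Type*} [NormedAddCommGroup E] [NormedSpace 𝕜 E]
    {y : ℕ → SolSpace 𝕜 E G} {a b : ℝ} (hy : UniformCauchyUpTo y a)
    (h : ∀ ε > 0, ∀ᶠ p : ℕ × ℕ in atTop ×ˢ atTop,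
      ∀ t ∈ Ioc a b, ‖(y p.1).eval t - (y p.2).eval t‖ ≤ ε) : UniformCauchyUpTo y b := by
  intro ε hε
  filter_upwards [hy ε hε, h ε hε] with p h1 h2 t ht
  rcases le_or_gt t a with hta | hta
  · exact h1 t ⟨ht.1, hta⟩
  · exact h2 t ⟨hta, ht.2⟩

/-- The impulses `h_i(t, ·)` are Lipschitz, uniformly in `t`, and act on the Cauchy sequence
`P^n y_n(ρ_i)`. -/
theorem UniformCauchyUpTo.impulse {y : ℕ → SolSpace 𝕜 (e.HFrac α) G} {a b L : ℝ}
    (ha0 : -G.τ ≤ a) (ha : a ≤ G.T) (hy : UniformCauchyUpTo y a) (hL : 0 < L)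
    {g : ℝ → e.HFrac α → e.HFrac α} {r : ℝ} (hr : ∀ n, ‖(y n).eval a‖ ≤ r)
    (hg : ∀ t ∈ Ioc a b, ∀ x z, ‖x‖ ≤ r → ‖z‖ ≤ r → ‖g t x - g t z‖ ≤ L * ‖x - z‖)
    (hsol : ∀ n, ∀ t ∈ Ioc a b, (y n).eval t = g t (e.projFrac n α ((y n).eval a))) :
    UniformCauchyUpTo y b := by
  refine hy.extend fun ε hε => ?_
  have hδ : 0 < ε / (3 * L) := by positivity
  have htail := hy.tailsVanishUpTo ha _ hδ
  filter_upwards [hy _ hδ, htail.prod_mk htail] with p h1 h2 t ht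
  have haa : a ∈ Icc (-G.τ) a := ⟨ha0, le_rfl⟩
  rw [hsol p.1 t ht, hsol p.2 t ht]
  refine (hg t ht _ _ ((e.norm_projFrac_le _ _).trans (hr _))
    ((e.norm_projFrac_le _ _).trans (hr _))).trans ?_
  have h3 := norm_projFrac_sub_projFrac_le p.1 p.2 ((y p.1).eval a) ((y p.2).eval a)
  calc L * _ ≤ L * (ε / (3 * L) + ε / (3 * L) + ε / (3 * L)) := by
        refine mul_le_mul_of_nonneg_left ?_ hL.le
        linarith [h1 a haa, h2.1 a haa, h2.2 a haa]
    _ = ε := by field_simp; norm_num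

variable {S : ℝ → H →L[𝕜] H} {F : Icc 0 G.T → HistSpace 𝕜 (e.HFrac α) G → H}

theorem forcing_of_mem {n : ℕ} {y : SolSpace 𝕜 (e.HFrac α) G} {s : ℝ} (hs : s ∈ Icc 0 G.T) :
    forcing F n y s = F ⟨s, hs⟩ (FinPCSpace.map (e.projFrac n α) (y.hist ⟨s, hs⟩)) :=
  IccExtend_of_mem _ _ hs

theorem norm_map_projFrac_hist_le {n : ℕ} {y : SolSpace 𝕜 (e.HFrac α) G} {r : ℝ} (hr0 : 0 ≤ r)
    (hr : ∀ t ∈ Icc (-G.τ) G.T, ‖y.eval t‖ ≤ r) (s : Icc 0 G.T) :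
    ‖FinPCSpace.map (e.projFrac n α) (y.hist s)‖ ≤ r :=
  norm_map_hist_le hr0 fun t ht =>
    (e.norm_projFrac_le _ _).trans (hr t ⟨ht.1, ht.2.trans s.2.2⟩)

section FreeEvolution

variable [NormedSpace ℝ H] [CompleteSpace H] {y : ℕ → SolSpace 𝕜 (e.HFrac α) G} {a b r : ℝ}

theorem UniformCauchyUpTo.tailsVanishUpTo_of_mild (hS : IsSemigroupGeneratedBy S (-A))
    (hα0 : 0 < α) (hα1 : α < 1) (ha : 0 ≤ a) (hb : b ≤ G.T) (haT : a ≤ G.T) (hr0 : 0 ≤ r)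
    (hr : ∀ n, ∀ t ∈ Icc (-G.τ) G.T, ‖(y n).eval t‖ ≤ r) {K : ℝ} (hK0 : 0 ≤ K)
    (hK : ∀ s x, ‖x‖ ≤ r → ‖F s x‖ ≤ K)
    (hint : ∀ n, ∀ t ∈ Icc a b,
      IntervalIntegrable (fun s => S (t - s) (forcing F n (y n) s)) volume a t)
    (hsol : ∀ n, ∀ t ∈ Icc a b, e.incl α ((y n).eval t) =
      S (t - a) (e.incl α ((y n).eval a)) + ∫ s in a..t, S (t - s) (forcing F n (y n) s))
    (hy : UniformCauchyUpTo y a) : TailsVanishUpTo y b := by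
  intro ε hε
  have hβ0 : 0 ≤ (1 + α) / 2 := by linarith
  have hαβ : α ≤ (1 + α) / 2 := by linarith
  have hβ1 : (1 + α) / 2 < 1 := by linarith
  set β := (1 + α) / 2 with hβ
  have hΓ := Real.Gamma_pos_of_pos (sub_pos.2 hβ1)
  set C : ℝ := K * (Real.exp (1 * G.T) * ((1 / 1) ^ (1 - β) * Real.Gamma (1 - β))) with hC
  have hlam : Tendsto (fun n => e.lam n ^ (α - β) * C) atTop (𝓝 0) := by
    have h1 := (tendsto_rpow_neg_atTop (y := β - α) (by linarith)).comp e.lam_tendsto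
    rw [neg_sub] at h1
    have h2 := h1.mul_const C
    rwa [zero_mul] at h2
  filter_upwards [hy.tailsVanishUpTo haT _ (half_pos hε),
    hlam.eventually_le_const (half_pos hε)] with n hn1 hn2 t ht
  rcases le_or_gt t a with hta | hta
  · linarith [hn1 t ⟨ht.1, hta⟩]
  have htab : t ∈ Icc a b := ⟨hta.le, ht.2⟩
  obtain ⟨z, hz, -, hztail⟩ := e.exists_semigroup_incl hS (sub_nonneg.2 hta.le) ((y n).eval a)
  have hv : e.incl α ((y n).eval t - z) = ∫ s in a..t, S (t - s) (forcing F n (y n) s) := by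
    rw [map_sub, hz, hsol n t htab, add_sub_cancel_left]
  have hf : ∀ u ∈ Icc a t, ‖forcing F n (y n) u‖ ≤ K * Real.exp (1 * u) := by
    intro u hu
    have hu0 : 0 ≤ u := ha.trans hu.1
    rw [forcing_of_mem ⟨hu0, hu.2.trans (ht.2.trans hb)⟩]
    refine (hK _ _ (norm_map_projFrac_hist_le hr0 (hr n) _)).trans ?_
    exact le_mul_of_one_le_right hK0 (Real.one_le_exp (by linarith))
  have h1 := e.norm_sub_projFrac_le_of_incl_eq_integral hS hβ0 hαβ hβ1 hta.le one_pos hK0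
    (hint n t htab) hf hv n
  have h2 : e.lam n ^ (α - β) *
      (K * (Real.exp (1 * t) * ((1 / 1) ^ (1 - β) * Real.Gamma (1 - β)))) ≤
      e.lam n ^ (α - β) * C := by
    have hn0 := Real.rpow_nonneg (e.lam_pos' n).le (α - β)
    have htT : t ≤ G.T := ht.2.trans hb
    rw [hC]
    gcongr
  have h3 : (y n).eval t - e.projFrac n α ((y n).eval t) =
      ((y n).eval t - z - e.projFrac n α ((y n).eval t - z)) + (z - e.projFrac n α z) := by
    rw [map_sub]
    abel
  have haa : a ∈ Icc (-G.τ) a := ⟨by linarith [G.τ_pos], le_rfl⟩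
  rw [h3]
  linarith [norm_add_le ((y n).eval t - z - e.projFrac n α ((y n).eval t - z))
    (z - e.projFrac n α z), hztail n, hn1 a haa]

/-- Between two impulses the Cauchy property is carried forward by the variation of constants
formula. In the norm weighted by `exp (-κ t)` with `κ` large, the convolution with the singular
kernel `(t - s) ^ (-α)` has norm at most `1 / 2`, which replaces a singular Gronwall inequality; the
weight decreases in time, so that the delay does no harm. -/
theorem UniformCauchyUpTo.of_mild (hS : IsSemigroupGeneratedBy S (-A))
    (hα0 : 0 < α) (hα1 : α < 1) (ha : 0 ≤ a) (hab : a ≤ b) (hb : b ≤ G.T) (hr0 : 0 ≤ r)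
    (hr : ∀ n, ∀ t ∈ Icc (-G.τ) G.T, ‖(y n).eval t‖ ≤ r) {K L : ℝ} (hK0 : 0 ≤ K)
    (hK : ∀ s x, ‖x‖ ≤ r → ‖F s x‖ ≤ K) (hL : 0 < L)
    (hF : ∀ s x z, ‖x‖ ≤ r → ‖z‖ ≤ r → ‖F s x - F s z‖ ≤ L * ‖x - z‖)
    (hint : ∀ n, ∀ t ∈ Icc a b,
      IntervalIntegrable (fun s => S (t - s) (forcing F n (y n) s)) volume a t)
    (hsol : ∀ n, ∀ t ∈ Icc a b, e.incl α ((y n).eval t) =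
      S (t - a) (e.incl α ((y n).eval a)) + ∫ s in a..t, S (t - s) (forcing F n (y n) s))
    (hy : UniformCauchyUpTo y a) : UniformCauchyUpTo y b := by
  intro ε hε
  have htail := hy.tailsVanishUpTo_of_mild hS hα0 hα1 ha hb (hab.trans hb) hr0 hr hK0 hK hint hsol
  obtain ⟨κ, hκ, hκ'⟩ := exists_pos_mul_rpow_mul_Gamma_le (sub_pos.2 hα1) L
  have hE : 0 < Real.exp (κ * G.T) * (2 * (2 + Real.exp (κ * G.τ))) := by positivity
  set δ := ε / (Real.exp (κ * G.T) * (2 * (2 + Real.exp (κ * G.τ)))) with hδdef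
  have hδ : 0 < δ := div_pos hε hE
  filter_upwards [hy δ hδ, (htail δ hδ).prod_mk (htail δ hδ)]
  rintro ⟨n, m⟩ hnm ⟨htn, htm⟩ t ht
  dsimp only at hnm htn htm ⊢
  have hexp_pos : ∀ s : ℝ, 0 < Real.exp (-(κ * s)) := fun s => Real.exp_pos _
  have hcancel : ∀ s : ℝ, Real.exp (-(κ * s)) * Real.exp (κ * s) = 1 := fun s => by
    rw [← Real.exp_add, neg_add_cancel, Real.exp_zero]
  have hweight : ∀ s ∈ Icc (-G.τ) b, Real.exp (-(κ * s)) ≤ Real.exp (κ * G.τ) := by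
    intro s hs
    refine Real.exp_le_exp.2 ?_
    nlinarith [hs.1]
  have key : ∀ s ∈ Icc (-G.τ) b,
      Real.exp (-(κ * s)) * ‖(y n).eval s - (y m).eval s‖ ≤
        2 * ((2 + Real.exp (κ * G.τ)) * δ) := by
    intro s hs
    refine le_two_mul_of_forall_le_add_half (X := Icc (-G.τ) b)
      (D := fun s => Real.exp (-(κ * s)) * ‖(y n).eval s - (y m).eval s‖)
      (B := Real.exp (κ * G.τ) * (r + r))
      (fun s _ => mul_nonneg (hexp_pos s).le (norm_nonneg _)) (fun s hs => ?_)
      (fun M hM0 hM s hs => ?_) hs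
    · have hs' : s ∈ Icc (-G.τ) G.T := ⟨hs.1, hs.2.trans hb⟩
      exact mul_le_mul (hweight s hs)
        ((norm_sub_le _ _).trans (add_le_add (hr n s hs') (hr m s hs'))) (norm_nonneg _)
        (Real.exp_pos _).le
    · have hM' : ∀ u ∈ Icc (-G.τ) b, ‖(y n).eval u - (y m).eval u‖ ≤ M * Real.exp (κ * u) := by
        intro u hu
        have h1 := mul_le_mul_of_nonneg_right (hM u hu) (Real.exp_pos (κ * u)).le
        rwa [mul_right_comm, hcancel, one_mul] at h1
      rcases le_or_gt s a with hsa | hsa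
      · have h1 : Real.exp (-(κ * s)) * ‖(y n).eval s - (y m).eval s‖ ≤
            Real.exp (κ * G.τ) * δ :=
          mul_le_mul (hweight s hs) (hnm s ⟨hs.1, hsa⟩) (norm_nonneg _) (Real.exp_pos _).le
        linarith
      have hsab : s ∈ Icc a b := ⟨hsa.le, hs.2⟩
      obtain ⟨z, hz, hzle, -⟩ := e.exists_semigroup_incl hS (sub_nonneg.2 hsa.le)
        ((y n).eval a - (y m).eval a)
      have hsub : (fun u => S (s - u) (forcing F n (y n) u - forcing F m (y m) u)) =
          fun u => S (s - u) (forcing F n (y n) u) - S (s - u) (forcing F m (y m) u) :=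
        funext fun u => map_sub _ _ _
      have hint' : IntervalIntegrable
          (fun u => S (s - u) (forcing F n (y n) u - forcing F m (y m) u)) volume a s := by
        rw [hsub]
        exact (hint n s hsab).sub (hint m s hsab)
      have hv : e.incl α ((y n).eval s - (y m).eval s - z) =
          ∫ u in a..s, S (s - u) (forcing F n (y n) u - forcing F m (y m) u) := by
        rw [hsub, intervalIntegral.integral_sub (hint n s hsab) (hint m s hsab), map_sub, map_sub,
          hz, hsol n s hsab, hsol m s hsab, map_sub, map_sub]
        abel
      have hM2 : 0 ≤ M + 2 * δ := by linarith
      have hf : ∀ u ∈ Icc a s, ‖forcing F n (y n) u - forcing F m (y m) u‖ ≤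
          L * (M + 2 * δ) * Real.exp (κ * u) := by
        intro u hu
        have hu0 : 0 ≤ u := ha.trans hu.1
        have hub : u ≤ b := hu.2.trans hs.2
        have hu' : u ∈ Icc 0 G.T := ⟨hu0, hub.trans hb⟩
        rw [forcing_of_mem hu', forcing_of_mem hu', mul_assoc]
        refine (hF _ _ _ (norm_map_projFrac_hist_le hr0 (hr n) _)
          (norm_map_projFrac_hist_le hr0 (hr m) _)).trans
          (mul_le_mul_of_nonneg_left ?_ hL.le)
        refine norm_map_hist_sub_map_hist_le (mul_nonneg hM2 (Real.exp_pos _).le) fun w hw => ?_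
        have hwu : w ≤ u := hw.2
        have hwb : w ∈ Icc (-G.τ) b := ⟨hw.1, hwu.trans hub⟩
        have h1 : Real.exp (κ * w) ≤ Real.exp (κ * u) :=
          Real.exp_le_exp.2 (mul_le_mul_of_nonneg_left hwu hκ.le)
        have h2 : 1 ≤ Real.exp (κ * u) := Real.one_le_exp (mul_nonneg hκ.le hu0)
        have h3 := norm_projFrac_sub_projFrac_le n m ((y n).eval w) ((y m).eval w)
        have h4 := mul_le_mul_of_nonneg_left h1 hM0
        have h5 := mul_le_mul_of_nonneg_left h2 hδ.le
        linarith [hM' w hwb, htn w hwb, htm w hwb]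
      have h1 := e.norm_le_of_incl_eq_integral hS hα0.le hα1 hsa.le hκ (mul_nonneg hL.le hM2)
        hint' hf hv
      have h2 : Real.exp (-(κ * s)) * ‖(y n).eval s - (y m).eval s - z‖ ≤ (M + 2 * δ) / 2 := by
        calc _ ≤ Real.exp (-(κ * s)) * (L * (M + 2 * δ) *
              (Real.exp (κ * s) * ((1 / κ) ^ (1 - α) * Real.Gamma (1 - α)))) :=
              mul_le_mul_of_nonneg_left h1 (hexp_pos s).le
          _ = (Real.exp (-(κ * s)) * Real.exp (κ * s)) * ((M + 2 * δ) *
              (L * ((1 / κ) ^ (1 - α) * Real.Gamma (1 - α)))) := by ring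
          _ ≤ (M + 2 * δ) / 2 := by
              rw [hcancel, one_mul]
              linarith [mul_le_mul_of_nonneg_left hκ' hM2]
      have haa : a ∈ Icc (-G.τ) a := ⟨by linarith [G.τ_pos], le_rfl⟩
      have h3 : Real.exp (-(κ * s)) * ‖z‖ ≤ δ := by
        have h4 : Real.exp (-(κ * s)) ≤ 1 :=
          Real.exp_le_one_iff.2 (neg_nonpos.2 (mul_nonneg hκ.le (ha.trans hsa.le)))
        exact (mul_le_of_le_one_left (norm_nonneg _) h4).trans (hzle.trans (hnm a haa))
      have h4 : ‖(y n).eval s - (y m).eval s‖ ≤ ‖(y n).eval s - (y m).eval s - z‖ + ‖z‖ := by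
        simpa using norm_add_le ((y n).eval s - (y m).eval s - z) z
      have h5 := mul_le_mul_of_nonneg_left h4 (hexp_pos s).le
      have h6 : 0 ≤ Real.exp (κ * G.τ) * δ := by positivity
      linarith
  have htT : Real.exp (κ * t) ≤ Real.exp (κ * G.T) :=
    Real.exp_le_exp.2 (mul_le_mul_of_nonneg_left (ht.2.trans hb) hκ.le)
  calc ‖(y n).eval t - (y m).eval t‖
      = Real.exp (κ * t) * (Real.exp (-(κ * t)) * ‖(y n).eval t - (y m).eval t‖) := by
        rw [← mul_assoc, mul_comm (Real.exp (κ * t)), hcancel, one_mul]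
    _ ≤ Real.exp (κ * G.T) * (2 * ((2 + Real.exp (κ * G.τ)) * δ)) :=
        mul_le_mul htT (key t ht) (mul_nonneg (hexp_pos t).le (norm_nonneg _)) (Real.exp_pos _).le
    _ = Real.exp (κ * G.T) * (2 * (2 + Real.exp (κ * G.τ))) * δ := by ring
    _ = ε := mul_div_cancel₀ _ hE.ne'

end FreeEvolution

end Propagation

end FaedoGalerkin

/-! ### Convergence of the approximate solutions -/

open FaedoGalerkin in
theorem theorem4p1
    {𝕜 : Type*} [RCLike 𝕜]
    {H : Type*} [NormedAddCommGroup H] [InnerProductSpace 𝕜 H] [NormedSpace ℝ H] [CompleteSpace H]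
    (A : H →ₗ.[𝕜] H)
    (hA_dense : Dense (A.domain : Set H)) (hA_sa : IsSelfAdjoint A) (hA_closed : A.IsClosed)
    (hA_pos : ∀ x : A.domain, (x : H) ≠ 0 → 0 < RCLike.re (inner 𝕜 (A x) (x : H)))
    (e : EigenSystem A)
    (S : ℝ → H →L[𝕜] H) (hS : IsSemigroupGeneratedBy S (-A))
    (G : TimeGrid) (α : ℝ) (hα0 : 0 < α) (hα1 : α < 1)
    (χ : HistSpace 𝕜 (e.HFrac α) G)
    (hχ_hoelder : ∀ t ∈ Set.Icc (-G.τ) 0, ∃ C r : NNReal, 0 < r ∧ r ≤ 1 ∧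
      ∃ U ∈ nhds t, HolderOnWith C r (fun θ => e.incl α (χ.eval θ)) (U ∩ Set.Icc (-G.τ) 0))
    (hχ_dom : ∀ t ∈ Set.Icc (-G.τ) 0, e.incl α (χ.eval t) ∈ A.domain)
    (R : ℝ) (hR : 0 < R)
    (F : Set.Icc 0 G.T → HistSpace 𝕜 (e.HFrac α) G → H)
    (hF_cont : Continuous (Function.uncurry F))
    (η LF : ℝ) (hη0 : 0 < η) (hη1 : η ≤ 1) (hLF : 0 < LF)
    (hF_lip : ∀ s t : Set.Icc 0 G.T, ∀ x z : HistSpace 𝕜 (e.HFrac α) G,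
      ‖x‖ ≤ R + ‖χ‖ → ‖z‖ ≤ R + ‖χ‖ →
        ‖F s x - F t z‖ ≤ LF * (|(s : ℝ) - t| ^ η + ‖x - z‖))
    (h : ℕ → ℝ → e.HFrac α → e.HFrac α)
    (hh_cont : ∀ i, 1 ≤ i → i ≤ G.q →
      ContinuousOn (Function.uncurry (h i)) (Set.Ioc (G.ρ i) (G.ς i) ×ˢ Set.univ))
    (Lh : ℕ → ℝ) (hLh : ∀ i, 1 ≤ i → i ≤ G.q → 0 < Lh i)
    (hh_lip : ∀ i, 1 ≤ i → i ≤ G.q →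
      ∀ s ∈ Set.Ioc (G.ρ i) (G.ς i), ∀ t ∈ Set.Ioc (G.ρ i) (G.ς i), ∀ x z : e.HFrac α,
        ‖x‖ ≤ R + ‖χ‖ → ‖z‖ ≤ R + ‖χ‖ → ‖h i s x - h i t z‖ ≤ Lh i * (|s - t| + ‖x - z‖))
    (Mh : ℝ) (hMh : 0 < Mh)
    (hh_bdd : ∀ i, 1 ≤ i → i ≤ G.q → ∀ t ∈ Set.Ioc (G.ρ i) (G.ς i), ∀ x : e.HFrac α,
      ‖h i t x‖ ≤ Mh)
    (y : ℕ → SolSpace 𝕜 (e.HFrac α) G)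
    (hy_ball : ∀ n, ∀ t ∈ Set.Icc (-G.τ) G.T, ‖(y n).eval t - χ.eval t‖ ≤ R)
    (hy_sol : ∀ n, IsApproxSolution S F h χ n (y n)) :
    CauchySeq y ∧
      ∃ yLim : SolSpace 𝕜 (e.HFrac α) G, Filter.Tendsto y Filter.atTop (nhds yLim) := by
  -- Consequences of the hypotheses on the ball of radius `r = R + ‖χ‖`, which contains all values.
  set r := R + ‖χ‖ with hr_def
  have hr0 : 0 ≤ r := add_nonneg hR.le (norm_nonneg _)
  have hr : ∀ n, ∀ t ∈ Set.Icc (-G.τ) G.T, ‖(y n).eval t‖ ≤ r := by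
    intro n t ht
    have h1 : ‖(y n).eval t‖ ≤ ‖(y n).eval t - χ.eval t‖ + ‖χ.eval t‖ := by
      simpa using norm_add_le ((y n).eval t - χ.eval t) (χ.eval t)
    linarith [hy_ball n t ht, χ.norm_eval_le t]
  have hF : ∀ s x z, ‖x‖ ≤ r → ‖z‖ ≤ r → ‖F s x - F s z‖ ≤ LF * ‖x - z‖ := by
    intro s x z hx hz
    have h1 := hF_lip s s x z hx hz
    rwa [sub_self, abs_zero, Real.zero_rpow hη0.ne', zero_add] at h1
  have hT0 : (0 : ℝ) ∈ Set.Icc 0 G.T := ⟨le_rfl, G.T_pos.le⟩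
  obtain ⟨K, hK0, hK⟩ : ∃ K, 0 ≤ K ∧ ∀ s x, ‖x‖ ≤ r → ‖F s x‖ ≤ K := by
    refine ⟨LF * (G.T ^ η + r) + ‖F ⟨0, hT0⟩ 0‖, ?_, fun s x hx => ?_⟩
    · have := Real.rpow_nonneg G.T_pos.le η
      positivity
    · have h1 := hF_lip s ⟨0, hT0⟩ x 0 hx (by rwa [norm_zero])
      have h2 : |(s : ℝ)| ^ η ≤ G.T ^ η := by
        refine Real.rpow_le_rpow (abs_nonneg _) ?_ hη0.le
        rw [abs_of_nonneg s.2.1]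
        exact s.2.2
      have h3 : ‖F s x‖ ≤ ‖F s x - F ⟨0, hT0⟩ 0‖ + ‖F ⟨0, hT0⟩ 0‖ := by
        simpa using norm_add_le (F s x - F ⟨0, hT0⟩ 0) (F ⟨0, hT0⟩ 0)
      rw [sub_zero, sub_zero] at h1
      have h4 : LF * (|(s : ℝ)| ^ η + ‖x‖) ≤ LF * (G.T ^ η + r) :=
        mul_le_mul_of_nonneg_left (add_le_add h2 hx) hLF.le
      linarith
  -- On each interval of free evolution, `y n` is the mild solution that starts from its own value.
  have hmild : ∀ i ≤ G.q, ∀ n, ∀ t ∈ Set.Icc (G.ς i) (G.ρ (i + 1)), e.incl α ((y n).eval t) =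
      S (t - G.ς i) (e.incl α ((y n).eval (G.ς i))) +
        ∫ s in (G.ς i)..t, S (t - s) (forcing F n (y n) s) := by
    intro i hi n t ht
    rcases Nat.eq_zero_or_pos i with rfl | hi0
    · rw [G.ς_zero] at ht ⊢
      rw [(hy_sol n).initial 0 ⟨G.neg_τ_le_zero, le_rfl⟩, sub_zero]
      exact (hy_sol n).first t ht
    · rcases ht.1.eq_or_lt with rfl | hlt
      · rw [sub_self, hS.map_zero, intervalIntegral.integral_same, add_zero]
        rfl
      · rw [(hy_sol n).impulse i hi0 hi (G.ς i) ⟨G.ρ_lt_ς i hi0 hi, le_rfl⟩]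
        exact (hy_sol n).later i hi0 hi t ⟨hlt, ht.2⟩
  have hfree : ∀ i ≤ G.q, UniformCauchyUpTo y (G.ς i) → UniformCauchyUpTo y (G.ρ (i + 1)) :=
    fun i hi hy => hy.of_mild hS hα0 hα1 (G.ς_nonneg hi) (G.ς_lt_ρ i hi).le (G.ρ_succ_le_T hi)
      hr0 hr hK0 hK hLF hF (fun n => (hy_sol n).integrable i hi) (hmild i hi)
  have hcauchy : ∀ i ≤ G.q, UniformCauchyUpTo y (G.ρ (i + 1)) := by
    intro i
    induction i with
    | zero =>
      intro hi
      refine hfree 0 hi fun ε hε => Filter.Eventually.of_forall fun p t ht => ?_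
      rw [G.ς_zero] at ht
      rw [(hy_sol p.1).initial t ht, (hy_sol p.2).initial t ht, sub_self, norm_zero]
      exact hε.le
    | succ i ih =>
      intro hi
      have hi1 : 1 ≤ i + 1 := Nat.le_add_left 1 i
      have hi' : i ≤ G.q := Nat.le_of_succ_le hi
      have hρ0 : -G.τ ≤ G.ρ (i + 1) := by
        linarith [G.τ_pos, G.ς_nonneg hi', G.ς_lt_ρ i hi']
      refine hfree (i + 1) hi ((ih hi').impulse hρ0 (G.ρ_succ_le_T hi') (hLh (i + 1) hi1 hi)
        (fun n => hr n _ ⟨hρ0, G.ρ_succ_le_T hi'⟩) (fun t ht x z hx hz => ?_)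
        (fun n => (hy_sol n).impulse (i + 1) hi1 hi))
      have h1 := hh_lip (i + 1) hi1 hi t ht t ht x z hx hz
      rwa [sub_self, abs_zero, zero_add] at h1
  have hT : UniformCauchyUpTo y G.T := by
    have h1 := hcauchy G.q le_rfl
    rwa [G.ρ_last] at h1
  have hseq : CauchySeq y := by
    refine Metric.cauchySeq_iff.2 fun ε hε => ?_
    obtain ⟨N, hN⟩ := hT.exists_forall (half_pos hε)
    refine ⟨N, fun n hn m hm => ?_⟩
    rw [dist_eq_norm]
    exact (SolSpace.norm_sub_le_of_forall (half_pos hε).le (hN n hn m hm)).trans_lt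
      (half_lt_self hε)
  have := e.completeSpace_hFrac hα0.le
  have := completeSpace_pcSpace 𝕜 (E := e.HFrac α) (a := -G.τ) (b := G.T) G.jumps
  exact ⟨hseq, cauchySeq_tendsto_of_complete hseq⟩
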